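/- Let $(M,g)$ be a non-empty compact smooth Riemannian manifold of dimension $3$ without boundary, with volume measure $dV$, and let $\varphi : M \to \mathbb{R}^4$ be an isometric immersion of class $C^2$ whose image lies in the closed ball $B^4(0,R)$ of radius $R>0$ centred at the origin. Let $K$ be the Gauss--Kronecker curvature of $\varphi$, that is, the product of the principal curvatures (the determinant of the shape operator with respect to a local unit normal; $|K|$ does not depend on the choice of the normal), and let $T(M)=\int_M |K|\,dV$ be the total curvature. If, for some $0<\alpha<6$, the Ricci curvature of $(M,g)$ satisfies $$\mathrm{Ric}(v,v)\ \ge\ -\frac{\alpha}{R^2}\,g(v,v)\qquad\text{for all tangent vectors } v,$$ then $\mathrm{vol}(M)$ and $T(M)$ are finite and $$\mathrm{vol}(M)\ <\ \frac{6}{6-\alpha}\,R^3\,T(M).$$ -/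

import Mathlib

open Set MeasureTheory
open scoped Manifold ContDiff Matrix

noncomputable section

namespace Hypersurface

/-- The model space `ℝ³` of the manifold. -/
abbrev E3 : Type := EuclideanSpace ℝ (Fin 3)

/-- The ambient Euclidean space `ℝ⁴`. -/
abbrev E4 : Type := EuclideanSpace ℝ (Fin 4)

/-- The `i`-th standard basis vector of `ℝ³`. -/
def stdVec (i : Fin 3) : E3 := EuclideanSpace.single i 1

/-- The partial derivative `∂ᵢ f` at `y`. -/
def pd {V : Type*} [NormedAddCommGroup V] [NormedSpace ℝ V]
    (i : Fin 3) (f : E3 → V) (y : E3) : V :=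
  fderiv ℝ f y (stdVec i)

/-! ### Intrinsic curvature in coordinates -/

/-- Christoffel symbols of the second kind of a metric with coefficient matrix `G`,
`Γᵏᵢⱼ = ½ ∑ₗ gᵏˡ (∂ᵢ gⱼₗ + ∂ⱼ gᵢₗ - ∂ₗ gᵢⱼ)`. -/
def christoffel (G : E3 → Matrix (Fin 3) (Fin 3) ℝ) (k i j : Fin 3) (y : E3) : ℝ :=
  (1 / 2) * ∑ l, (G y)⁻¹ k l *
    (pd i (fun z => G z j l) y + pd j (fun z => G z i l) y - pd l (fun z => G z i j) y)

/-- Coefficients of the Ricci tensor of a metric with coefficient matrix `G`,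
`Rᵢⱼ = ∑ₖ (∂ₖ Γᵏᵢⱼ - ∂ⱼ Γᵏᵢₖ) + ∑ₖ ∑ₗ (Γᵏₖₗ Γˡᵢⱼ - Γᵏⱼₗ Γˡᵢₖ)`
(with this sign convention the unit round 3-sphere has `Ric = 2 g`). -/
def ricciCoeff (G : E3 → Matrix (Fin 3) (Fin 3) ℝ) (i j : Fin 3) (y : E3) : ℝ :=
  (∑ k, (pd k (christoffel G k i j) y - pd j (christoffel G k i k) y)) +
    ∑ k, ∑ l, (christoffel G k k l y * christoffel G l i j y -
      christoffel G k j l y * christoffel G l i k y)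

/-! ### Immersed parametrized hypersurfaces of `ℝ⁴` -/

/-- The vector product of three vectors of `ℝ⁴`: the vector whose inner product with `w` is
`det (a, b, c, w)`. -/
def cross (a b c : E4) : E4 :=
  WithLp.toLp 2 fun k => (Matrix.of ![a.ofLp, b.ofLp, c.ofLp, Pi.single k 1]).det

/-- The unit normal `ν` of a parametrized hypersurface `F`. -/
def unitNormal (F : E3 → E4) (y : E3) : E4 :=
  ‖cross (pd 0 F y) (pd 1 F y) (pd 2 F y)‖⁻¹ • cross (pd 0 F y) (pd 1 F y) (pd 2 F y)

/-- The matrix `⟨∂ᵢF, ∂ⱼF⟩` of the first fundamental form. -/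
def firstForm (F : E3 → E4) (y : E3) : Matrix (Fin 3) (Fin 3) ℝ :=
  Matrix.of fun i j => inner ℝ (pd i F y) (pd j F y)

/-- The matrix `⟨∂ᵢ∂ⱼF, ν⟩` of the second fundamental form. -/
def secondForm (F : E3 → E4) (y : E3) : Matrix (Fin 3) (Fin 3) ℝ :=
  Matrix.of fun i j => inner ℝ (pd i (pd j F) y) (unitNormal F y)

/-- The Gauss-Kronecker curvature: the determinant of the shape operator, i.e. the product of
the principal curvatures. Its sign depends on the choice of unit normal. -/
def gaussKroneckerCoord (F : E3 → E4) (y : E3) : ℝ :=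
  ((firstForm F y)⁻¹ * secondForm F y).det

/-! ### Riemannian 3-manifolds -/

section Manifold

variable {M : Type*} [TopologicalSpace M] [ChartedSpace E3 M]

/-- The `i`-th coordinate vector field of the chart at `x`, evaluated at the point of `M` with
coordinates `y`. -/
def coordVec (x : M) (i : Fin 3) (y : E3) : TangentSpace (𝓡 3) ((chartAt E3 x).symm y) :=
  mfderiv (𝓡 3) (𝓡 3) (chartAt E3 x).symm y (stdVec i)

variable [IsManifold (𝓡 3) ∞ M]

variable (M) in
/-- Smooth Riemannian metrics on `M`. -/
abbrev SmoothMetric : Type _ :=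
  Bundle.ContMDiffRiemannianMetric (𝓡 3) ∞ E3 (fun p : M => TangentSpace (𝓡 3) p)

/-- The coefficients `gᵢⱼ` of the metric in the chart at `x`. -/
def metricCoeff (g : SmoothMetric M) (x : M) (y : E3) : Matrix (Fin 3) (Fin 3) ℝ :=
  Matrix.of fun i j => g.inner ((chartAt E3 x).symm y) (coordVec x i y) (coordVec x j y)

/-- The Ricci tensor of `g` at `p`, computed in the chart at `p`. -/
def ricci (g : SmoothMetric M) (p : M) (v w : TangentSpace (𝓡 3) p) : ℝ :=
  let v' : E3 := mfderiv (𝓡 3) (𝓡 3) (chartAt E3 p) p v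
  let w' : E3 := mfderiv (𝓡 3) (𝓡 3) (chartAt E3 p) p w
  ∑ i, ∑ j, ricciCoeff (metricCoeff g p) i j (chartAt E3 p p) * v' i * w' j

variable [MeasurableSpace M]

/-- The Riemannian volume measure of the domain of the chart at `x`, as a measure on `M`: the
image of `√(det gᵢⱼ) dy` on the target of the chart. -/
def chartVolume (g : SmoothMetric M) (x : M) : Measure M :=
  ((volume.restrict (chartAt E3 x).target).withDensity
    (fun y => ENNReal.ofReal √(metricCoeff g x y).det)).map (chartAt E3 x).symm

/-- The Riemannian volume measure. The measures `chartVolume g x` agree on overlaps of charts, so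
that their least upper bound is the measure which restricts to each of them on the domain of
the corresponding chart. -/
def vol (g : SmoothMetric M) : Measure M := ⨆ x : M, chartVolume g x

end Manifold

section Immersion

variable {M : Type*} [TopologicalSpace M] [ChartedSpace E3 M]

/-- The Gauss-Kronecker curvature of `φ` at `p`, for the unit normal attached to the orientation
of the chart at `p`; its absolute value does not depend on this choice. -/
def gaussKronecker (φ : M → E4) (p : M) : ℝ :=
  gaussKroneckerCoord (φ ∘ (chartAt E3 p).symm) (chartAt E3 p p)

variable [IsManifold (𝓡 3) ∞ M]

/-- `φ` is an isometric immersion of class `C²` of `(M, g)` into `ℝ⁴`. -/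
structure IsIsometricImmersion (g : SmoothMetric M) (φ : M → E4) : Prop where
  contMDiff : ContMDiff (𝓡 3) (𝓡 4) 2 φ
  isometric : ∀ (p : M) (v w : TangentSpace (𝓡 3) p),
    inner (E := E4) ℝ (mfderiv (𝓡 3) (𝓡 4) φ p v) (mfderiv (𝓡 3) (𝓡 4) φ p w) = g.inner p v w

/-- The total curvature `T(M) = ∫_M |K| dV`. -/
def totalCurvature [MeasurableSpace M] (g : SmoothMetric M) (φ : M → E4) : ℝ :=
  ∫ p, |gaussKronecker φ p| ∂(vol g)

end Immersion

end Hypersurface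

end

/-! The proof is an integral formula. Let `X` be the position vector, `ν` a unit normal, `p = ⟨X,
ν⟩` and `T` the tangential part of `X`. The 2-form `det(X, ν, dX, dX) + p det(X, ν, dX, dν) + p²
det(X, ν, dν, dν)` has exterior derivative `(6 + Ric(T,T) + 2pK(3p² - 2|T|²)) dV`: its terms in the
mean and second mean curvature cancel between consecutive summands, `dp` produces the Ricci term
through the Gauss equation, and only `K` survives beside it (`density_one`). Every summand is odd
under `ν ↦ -ν`, so the derivative is a density on `M` and no orientation is needed
(`IsReparametrization.density_eq`). Stokes then gives integral zero (`integral_formDiv_one`).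

From `|T|² + p² ≤ R²` follows `|2pK(3p² - 2|T|²)| ≤ 6R³|K|`, and the Ricci bound yields `6 -
(α/R²)|T|² - 6R³|K|` as a lower bound for the integrand (`formDiv_one_ge`). Integration gives `6
vol(M) ≤ (α/R²) ∫|T|² + 6R³ T(M)`. Since `|T|² ≤ R²`, and `T` vanishes at a point of `M` farthest
from the origin, `∫|T|² < R² vol(M)`, which is the strict inequality.

Two steps need care because `φ` is only `C²`. The normal is only `C¹`, so Stokes is proved for forms
`dθ ∧ dv ∧ dw` with `C¹` functions, by mollification (`integral_jac_eq_zero`). The Gauss equation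
formally uses third derivatives of `φ`; it is obtained weakly, and continuity makes it pointwise,
because the metric itself is smooth (`pd_inner_pd_pd_sub`, `ricciCoeff_firstForm`). -/

noncomputable section

namespace Hypersurface

open Filter Topology

/-! ### Calculus of partial derivatives on `ℝ³`. -/

section PartialDerivatives

variable {V W : Type*} [NormedAddCommGroup V] [NormedSpace ℝ V]
  [NormedAddCommGroup W] [NormedSpace ℝ W]

lemma norm_stdVec (i : Fin 3) : ‖stdVec i‖ = 1 := by simp [stdVec]

lemma pd_congr {i : Fin 3} {f f' : E3 → V} {y : E3} (h : f =ᶠ[𝓝 y] f') : pd i f y = pd i f' y := by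
  unfold pd; rw [h.fderiv_eq]

lemma pd_eventuallyEq {i : Fin 3} {f f' : E3 → V} {y : E3} (h : f =ᶠ[𝓝 y] f') :
    pd i f =ᶠ[𝓝 y] pd i f' := by
  filter_upwards [h.eventuallyEq_nhds] with z hz using pd_congr hz

lemma norm_pd_le (i : Fin 3) (f : E3 → V) (y : E3) : ‖pd i f y‖ ≤ ‖fderiv ℝ f y‖ := by
  simpa [pd, norm_stdVec] using (fderiv ℝ f y).le_opNorm (stdVec i)

lemma pd_add {i : Fin 3} {f h : E3 → V} {y : E3} (hf : DifferentiableAt ℝ f y)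
    (hh : DifferentiableAt ℝ h y) : pd i (fun z => f z + h z) y = pd i f y + pd i h y := by
  simp [pd, fderiv_fun_add hf hh]

lemma pd_sub {i : Fin 3} {f h : E3 → V} {y : E3} (hf : DifferentiableAt ℝ f y)
    (hh : DifferentiableAt ℝ h y) : pd i (fun z => f z - h z) y = pd i f y - pd i h y := by
  simp [pd, fderiv_fun_sub hf hh]

lemma pd_const (i : Fin 3) (c : V) (y : E3) : pd i (fun _ => c) y = 0 := by
  simp [pd]

lemma pd_mul {i : Fin 3} {f h : E3 → ℝ} {y : E3} (hf : DifferentiableAt ℝ f y)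
    (hh : DifferentiableAt ℝ h y) :
    pd i (fun z => f z * h z) y = pd i f y * h y + f y * pd i h y := by
  simp [pd, fderiv_fun_mul hf hh]; ring

lemma pd_smul {i : Fin 3} {f : E3 → ℝ} {h : E3 → V} {y : E3} (hf : DifferentiableAt ℝ f y)
    (hh : DifferentiableAt ℝ h y) :
    pd i (fun z => f z • h z) y = pd i f y • h y + f y • pd i h y := by
  simp [pd, fderiv_fun_smul hf hh]; abel

lemma pd_sum {ι : Type*} {s : Finset ι} {i : Fin 3} {f : ι → E3 → V} {y : E3}
    (hf : ∀ a ∈ s, DifferentiableAt ℝ (f a) y) :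
    pd i (fun z => ∑ a ∈ s, f a z) y = ∑ a ∈ s, pd i (f a) y := by
  simp [pd, fderiv_fun_sum hf]

lemma pd_inner {V : Type*} [NormedAddCommGroup V] [InnerProductSpace ℝ V] {i : Fin 3}
    {f h : E3 → V} {y : E3} (hf : DifferentiableAt ℝ f y) (hh : DifferentiableAt ℝ h y) :
    pd i (fun z => inner ℝ (f z) (h z)) y
      = inner ℝ (pd i f y) (h y) + inner ℝ (f y) (pd i h y) := by
  simp [pd, fderiv_inner_apply ℝ hf hh]; ring

lemma pd_clm (L : V →L[ℝ] W) {i : Fin 3} {f : E3 → V} {y : E3} (hf : DifferentiableAt ℝ f y) :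
    pd i (fun z => L (f z)) y = L (pd i f y) := by
  have := (L.hasFDerivAt.comp y hf.hasFDerivAt).fderiv
  simp only [pd]
  rw [show (fun z => L (f z)) = L ∘ f from rfl, this]; rfl

lemma pd_apply {i : Fin 3} {f : E3 → E4} {y : E3} (hf : DifferentiableAt ℝ f y) (a : Fin 4) :
    pd i (fun z => f z a) y = pd i f y a :=
  pd_clm (EuclideanSpace.proj a) hf

lemma contDiffOn_pd {n m : ℕ∞ω} {U : Set E3} (hU : IsOpen U) {f : E3 → V}
    (hf : ContDiffOn ℝ n f U) (h : m + 1 ≤ n) (i : Fin 3) : ContDiffOn ℝ m (pd i f) U :=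
  (hf.fderiv_of_isOpen hU h).clm_apply contDiffOn_const

lemma contDiff_pd {n m : ℕ∞ω} {f : E3 → V}
    (hf : ContDiff ℝ n f) (h : m + 1 ≤ n) (i : Fin 3) : ContDiff ℝ m (pd i f) :=
  (hf.fderiv_right h).clm_apply contDiff_const

lemma pd_comm {f : E3 → V} {y : E3} (hf : ContDiffAt ℝ 2 f y) (i j : Fin 3) :
    pd i (pd j f) y = pd j (pd i f) y := by
  have hs : IsSymmSndFDerivAt ℝ f y := hf.isSymmSndFDerivAt (by simp)
  have hd : DifferentiableAt ℝ (fderiv ℝ f) y :=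
    (hf.fderiv_right (m := 1) (by norm_num)).differentiableAt (by norm_num)
  have key : ∀ i j, pd i (pd j f) y = fderiv ℝ (fderiv ℝ f) y (stdVec i) (stdVec j) := by
    intro i j
    have : pd j f = fun z => fderiv ℝ f z (stdVec j) := rfl
    rw [this, pd, fderiv_clm_apply hd (by fun_prop)]
    simp
  rw [key, key]; exact hs _ _

lemma pd_eq_zero_of_notMem_tsupport {f : E3 → V} {y : E3} (h : y ∉ tsupport f) (i : Fin 3) :
    pd i f y = 0 := by
  have : f =ᶠ[𝓝 y] fun _ => 0 := by
    exact notMem_tsupport_iff_eventuallyEq.1 h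
  rw [pd_congr this, pd_const]

lemma contDiff_of_contDiffOn_of_tsupport_subset {n : ℕ∞ω} {U : Set E3} (hU : IsOpen U)
    {f : E3 → V} (hf : ContDiffOn ℝ n f U) (h : tsupport f ⊆ U) : ContDiff ℝ n f := by
  rw [contDiff_iff_contDiffAt]
  intro y
  by_cases hy : y ∈ tsupport f
  · exact hf.contDiffAt (hU.mem_nhds (h hy))
  · exact (contDiffAt_const (c := (0 : V))).congr_of_eventuallyEq
      (notMem_tsupport_iff_eventuallyEq.1 hy)

end PartialDerivatives

/-! ### Jacobian determinants and Stokes' theorem for functions of class `C¹`. -/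

/-- The Jacobian determinant of three functions on `ℝ³`. -/
def jac (u v w : E3 → ℝ) (y : E3) : ℝ :=
  (Matrix.of ![fun i => pd i u y, fun i => pd i v y, fun i => pd i w y]).det

lemma jac_eq (u v w : E3 → ℝ) (y : E3) : jac u v w y =
    pd 0 u y * (pd 1 v y * pd 2 w y - pd 2 v y * pd 1 w y) +
    pd 1 u y * (pd 2 v y * pd 0 w y - pd 0 v y * pd 2 w y) +
    pd 2 u y * (pd 0 v y * pd 1 w y - pd 1 v y * pd 0 w y) := by
  simp [jac, Matrix.det_fin_three]; ring

lemma jac_congr {u v w u' v' w' : E3 → ℝ} {y : E3} (hu : u =ᶠ[𝓝 y] u') (hv : v =ᶠ[𝓝 y] v')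
    (hw : w =ᶠ[𝓝 y] w') : jac u v w y = jac u' v' w' y := by
  simp only [jac_eq, pd_congr hu, pd_congr hv, pd_congr hw]

lemma jac_eq_zero_of_notMem_tsupport {u : E3 → ℝ} {y : E3} (h : y ∉ tsupport u)
    (v w : E3 → ℝ) : jac u v w y = 0 := by
  simp [jac_eq, pd_eq_zero_of_notMem_tsupport h]

lemma abs_jac_le (u v w : E3 → ℝ) (y : E3) :
    |jac u v w y| ≤ 6 * (‖fderiv ℝ u y‖ * (‖fderiv ℝ v y‖ * ‖fderiv ℝ w y‖)) := by
  have h : ∀ i j k, |pd i u y * (pd j v y * pd k w y)| ≤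
      ‖fderiv ℝ u y‖ * (‖fderiv ℝ v y‖ * ‖fderiv ℝ w y‖) := by
    intro i j k
    rw [abs_mul, abs_mul]
    have h1 := norm_pd_le i u y
    have h2 := norm_pd_le j v y
    have h3 := norm_pd_le k w y
    rw [Real.norm_eq_abs] at h1 h2 h3
    gcongr
  rw [jac_eq, abs_le]
  have h1 := abs_le.1 (h 0 1 2)
  have h2 := abs_le.1 (h 0 2 1)
  have h3 := abs_le.1 (h 1 2 0)
  have h4 := abs_le.1 (h 1 0 2)
  have h5 := abs_le.1 (h 2 0 1)
  have h6 := abs_le.1 (h 2 1 0)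
  constructor <;> linarith

lemma continuousOn_jac {U : Set E3} (hU : IsOpen U) {u v w : E3 → ℝ} (hu : ContDiffOn ℝ 1 u U)
    (hv : ContDiffOn ℝ 1 v U) (hw : ContDiffOn ℝ 1 w U) : ContinuousOn (jac u v w) U := by
  have h : ∀ {f : E3 → ℝ} (_ : ContDiffOn ℝ 1 f U) (i : Fin 3), ContinuousOn (pd i f) U :=
    fun hf i => (contDiffOn_pd (m := 0) hU hf (by norm_num) i).continuousOn
  rw [show jac u v w = _ from funext fun y => jac_eq u v w y]
  have := h hu; have := h hv; have := h hw
  fun_prop (disch := assumption)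

section Integrals

/-- Mollification: the derivative of the convolution is the convolution of the derivative, which is
uniformly close to `fderiv ℝ h` because the latter is uniformly continuous. Only derivatives are
compared, as a Jacobian depends on nothing else. -/
lemma exists_contDiff_norm_fderiv_sub_le {h : E3 → ℝ} (hh : ContDiff ℝ 1 h)
    (hc : HasCompactSupport h) {ε : ℝ} (hε : 0 < ε) :
    ∃ f : E3 → ℝ, ContDiff ℝ ∞ f ∧ ∀ y, ‖fderiv ℝ f y - fderiv ℝ h y‖ ≤ ε := by
  have hcont : Continuous (fderiv ℝ h) := hh.continuous_fderiv (by norm_num)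
  have huc : UniformContinuous (fderiv ℝ h) :=
    hcont.uniformContinuous_of_tendsto_cocompact (x := 0)
      ((hc.fderiv ℝ).is_zero_at_infty)
  obtain ⟨δ, hδ, hδε⟩ := Metric.uniformContinuous_iff.1 huc ε hε
  -- The support of the mollifier lies within the radius `δ` supplied by uniform continuity for `ε`.
  let b : ContDiffBump (0 : E3) := ⟨δ / 2, δ, by positivity, by linarith⟩
  have hbc : HasCompactSupport (b.normed volume) := b.hasCompactSupport_normed
  have hbs : ContDiff ℝ ∞ (b.normed volume) := b.contDiff_normed
  refine ⟨MeasureTheory.convolution (b.normed volume) h (ContinuousLinearMap.lsmul ℝ ℝ) volume,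
    hbc.contDiff_convolution_left _ hbs hh.continuous.locallyIntegrable, fun y => ?_⟩
  have h1 := hc.hasFDerivAt_convolution_right (ContinuousLinearMap.lsmul ℝ ℝ)
    (hbs.continuous.locallyIntegrable (μ := volume)) hh y
  rw [h1.fderiv]
  have h2 : MeasureTheory.convolution (b.normed volume) (fderiv ℝ h)
      ((ContinuousLinearMap.lsmul ℝ ℝ : ℝ →L[ℝ] ℝ →L[ℝ] ℝ).precompR E3) volume y =
      MeasureTheory.convolution (b.normed volume) (fderiv ℝ h)
      (ContinuousLinearMap.lsmul ℝ ℝ) volume y := by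
    unfold MeasureTheory.convolution
    congr 1
  rw [h2, ← dist_eq_norm]
  refine b.dist_normed_convolution_le hcont.aestronglyMeasurable fun x hx => ?_
  exact (hδε hx).le

lemma integral_pd_eq_zero {f : E3 → ℝ} (hf : ContDiff ℝ 1 f) (hc : HasCompactSupport f)
    (i : Fin 3) : ∫ y, pd i f y = 0 := by
  have hi : Integrable (pd i f) :=
    (contDiff_pd (m := 0) hf (by norm_num) i).continuous.integrable_of_hasCompactSupport
      (hc.fderiv_apply ℝ _)
  have := integral_mul_fderiv_eq_neg_fderiv_mul_of_integrable (μ := (volume : Measure E3))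
    (f := fun _ => (1 : ℝ)) (g := f) (v := stdVec i) (by simp) (by simpa using! hi)
    (by simpa using hf.continuous.integrable_of_hasCompactSupport hc)
    (by fun_prop) (fun x _ => hf.differentiable (by norm_num) x)
  simpa [pd] using this

/-- Expansion along the row of `θ`: the cofactors `C i` of the other two rows form a divergence-free
field, by symmetry of second derivatives, so the Jacobian is the divergence of `θ C`. For this `θ`
need only be `C¹`. -/
lemma integral_jac_eq_zero_of_contDiff_two {θ v w : E3 → ℝ} (hθ : ContDiff ℝ 1 θ)
    (hc : HasCompactSupport θ) (hv : ContDiff ℝ 2 v) (hw : ContDiff ℝ 2 w) :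
    ∫ y, jac θ v w y = 0 := by
  let C : Fin 3 → E3 → ℝ := ![fun y => pd 1 v y * pd 2 w y - pd 2 v y * pd 1 w y,
    fun y => pd 2 v y * pd 0 w y - pd 0 v y * pd 2 w y,
    fun y => pd 0 v y * pd 1 w y - pd 1 v y * pd 0 w y]
  have h1 : ∀ i, ContDiff ℝ 1 (pd i v) := contDiff_pd hv (by norm_num)
  have h2 : ∀ i, ContDiff ℝ 1 (pd i w) := contDiff_pd hw (by norm_num)
  have hC : ∀ i, ContDiff ℝ 1 (C i) := by
    intro i; fin_cases i
    · exact ((h1 1).mul (h2 2)).sub ((h1 2).mul (h2 1))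
    · exact ((h1 2).mul (h2 0)).sub ((h1 0).mul (h2 2))
    · exact ((h1 0).mul (h2 1)).sub ((h1 1).mul (h2 0))
  have hθC : ∀ i, ContDiff ℝ 1 (fun y => θ y * C i y) := fun i => hθ.mul (hC i)
  have hcC : ∀ i, HasCompactSupport (fun y => θ y * C i y) := fun i => hc.mul_right
  have hint : ∀ i, Integrable (pd i (fun y => θ y * C i y)) := fun i =>
    (contDiff_pd (m := 0) (hθC i) (by norm_num) i).continuous.integrable_of_hasCompactSupport
      ((hcC i).fderiv_apply ℝ _)
  have key : ∀ y, jac θ v w y = ∑ i, pd i (fun y => θ y * C i y) y := by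
    intro y
    have hd : ∀ {f : E3 → ℝ}, ContDiff ℝ 1 f → DifferentiableAt ℝ f y :=
      fun hf => hf.differentiable (by norm_num) y
    have e1 : ∀ i, pd i (fun y => θ y * C i y) y = pd i θ y * C i y + θ y * pd i (C i) y :=
      fun i => pd_mul (hd hθ) (hd (hC i))
    have e2 : ∀ k i j, pd k (fun y => pd i v y * pd j w y - pd j v y * pd i w y) y =
        pd k (pd i v) y * pd j w y + pd i v y * pd k (pd j w) y -
        (pd k (pd j v) y * pd i w y + pd j v y * pd k (pd i w) y) := by
      intro k i j
      rw [pd_sub (hd ((h1 i).mul (h2 j))) (hd ((h1 j).mul (h2 i))), pd_mul (hd (h1 i)) (hd (h2 j)),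
        pd_mul (hd (h1 j)) (hd (h2 i))]
    have d0 := e2 0 1 2
    have d1 := e2 1 2 0
    have d2 := e2 2 0 1
    have c0 : C 0 = fun y => pd 1 v y * pd 2 w y - pd 2 v y * pd 1 w y := rfl
    have c1 : C 1 = fun y => pd 2 v y * pd 0 w y - pd 0 v y * pd 2 w y := rfl
    have c2 : C 2 = fun y => pd 0 v y * pd 1 w y - pd 1 v y * pd 0 w y := rfl
    rw [← c0] at d0; rw [← c1] at d1; rw [← c2] at d2
    simp only [Fin.sum_univ_three, e1, d0, d1, d2, jac_eq]
    simp only [c0, c1, c2]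
    rw [pd_comm (f := v) hv.contDiffAt 1 0, pd_comm (f := v) hv.contDiffAt 2 0,
      pd_comm (f := v) hv.contDiffAt 2 1, pd_comm (f := w) hw.contDiffAt 1 0,
      pd_comm (f := w) hw.contDiffAt 2 0, pd_comm (f := w) hw.contDiffAt 2 1]
    ring
  simp only [key]
  rw [integral_finsetSum _ fun i _ => hint i]
  exact Finset.sum_eq_zero fun i _ => integral_pd_eq_zero (hθC i) (hcC i) i

/-- The functions `v`, `w` are replaced by smooth ones with uniformly close derivatives; `θ` is left
alone, and its compact support dominates the integrands. -/
lemma integral_jac_eq_zero_of_hasCompactSupport {θ v w : E3 → ℝ} (hθ : ContDiff ℝ 1 θ)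
    (hc : HasCompactSupport θ) (hv : ContDiff ℝ 1 v) (hvc : HasCompactSupport v)
    (hw : ContDiff ℝ 1 w) (hwc : HasCompactSupport w) :
    ∫ y, jac θ v w y = 0 := by
  have hpos : ∀ n : ℕ, (0 : ℝ) < 1 / ((n : ℝ) + 1) := fun n => by positivity
  choose a ha ha' using fun n : ℕ => exists_contDiff_norm_fderiv_sub_le hv hvc (hpos n)
  choose b hb hb' using fun n : ℕ => exists_contDiff_norm_fderiv_sub_le hw hwc (hpos n)
  have hbound : ∀ {f : E3 → ℝ}, ContDiff ℝ 1 f → HasCompactSupport f →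
      ∃ A, ∀ y, ‖fderiv ℝ f y‖ ≤ A := fun hf hfc =>
    (hf.continuous_fderiv (by norm_num)).bounded_above_of_compact_support (hfc.fderiv ℝ)
  obtain ⟨A, hA⟩ := hbound hv hvc
  obtain ⟨B, hB⟩ := hbound hw hwc
  have hconv : ∀ {f : E3 → ℝ} {s : ℕ → E3 → ℝ},
      (∀ n y, ‖fderiv ℝ (s n) y - fderiv ℝ f y‖ ≤ 1 / ((n : ℝ) + 1)) → ∀ i y,
      Tendsto (fun n => pd i (s n) y) atTop (𝓝 (pd i f y)) := by
    intro f s hs i y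
    rw [tendsto_iff_norm_sub_tendsto_zero]
    refine squeeze_zero (fun _ => norm_nonneg _) (fun n => ?_)
      (tendsto_one_div_add_atTop_nhds_zero_nat (𝕜 := ℝ))
    have := (fderiv ℝ (s n) y - fderiv ℝ f y).le_opNorm (stdVec i)
    rw [norm_stdVec, mul_one] at this
    exact this.trans (hs n y)
  have hle : ∀ {f : E3 → ℝ} {s : ℕ → E3 → ℝ} {A : ℝ},
      (∀ n y, ‖fderiv ℝ (s n) y - fderiv ℝ f y‖ ≤ 1 / ((n : ℝ) + 1)) →
      (∀ y, ‖fderiv ℝ f y‖ ≤ A) → ∀ n y, ‖fderiv ℝ (s n) y‖ ≤ A + 1 := by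
    intro f s A hs hA n y
    have h1 : ‖fderiv ℝ (s n) y‖ ≤ ‖fderiv ℝ (s n) y - fderiv ℝ f y‖ + ‖fderiv ℝ f y‖ := by
      simpa using norm_add_le (fderiv ℝ (s n) y - fderiv ℝ f y) (fderiv ℝ f y)
    have h2 : 1 / ((n : ℝ) + 1) ≤ 1 := by
      rw [div_le_one (by positivity)]; linarith [n.cast_nonneg (α := ℝ)]
    linarith [hs n y, hA y]
  have hlim : Tendsto (fun n => ∫ y, jac θ (a n) (b n) y) atTop (𝓝 (∫ y, jac θ v w y)) := by
    -- The derivatives of the approximations are within `1/(n+1) ≤ 1` of those of `v` and `w`,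
    -- whence the bounds `A + 1` and `B + 1`.
    refine tendsto_integral_of_dominated_convergence
      (fun y => 6 * (‖fderiv ℝ θ y‖ * ((A + 1) * (B + 1)))) (fun n => ?_) ?_ (fun n => ?_) ?_
    · have := continuousOn_jac isOpen_univ hθ.contDiffOn
        ((ha n).of_le (by simp)).contDiffOn ((hb n).of_le (by simp)).contDiffOn
      exact (continuousOn_univ.1 this).aestronglyMeasurable
    · have : Integrable (fderiv ℝ θ) := (hθ.continuous_fderiv (by norm_num)
        ).integrable_of_hasCompactSupport (hc.fderiv ℝ)
      exact (this.norm.mul_const _).const_mul _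
    · refine Eventually.of_forall fun y => (abs_jac_le _ _ _ _).trans ?_
      have h1 := hle ha' hA n y
      have h2 := hle hb' hB n y
      have h3 : 0 ≤ A + 1 := (norm_nonneg _).trans h1
      gcongr
    · refine Eventually.of_forall fun y => ?_
      have h1 := fun i => hconv ha' i y
      have h2 := fun i => hconv hb' i y
      have h := fun i j => (h1 i).mul (h2 j)
      simp only [jac_eq]
      exact ((((h 1 2).sub (h 2 1)).const_mul _).add
        (((h 2 0).sub (h 0 2)).const_mul _)).add (((h 0 1).sub (h 1 0)).const_mul _)
  refine tendsto_nhds_unique hlim ?_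
  have : ∀ n, ∫ y, jac θ (a n) (b n) y = 0 := fun n =>
    integral_jac_eq_zero_of_contDiff_two hθ hc
      ((ha n).of_le (by norm_cast)) ((hb n).of_le (by norm_cast))
  simp [this]

/-- A cutoff extends functions given only on `U`. Agreement near `K`, not just on it, is what makes
the derivatives agree there. -/
lemma exists_contDiff_hasCompactSupport_eventuallyEq {U K : Set E3} (hU : IsOpen U)
    (hK : IsCompact K) (hKU : K ⊆ U) {h : E3 → ℝ} (hh : ContDiffOn ℝ 1 h U) :
    ∃ f : E3 → ℝ, ContDiff ℝ 1 f ∧ HasCompactSupport f ∧ ∀ y ∈ K, f =ᶠ[𝓝 y] h := by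
  obtain ⟨L, hL, hKL, hLU⟩ := exists_compact_between hK hU hKU
  obtain ⟨χ, hχ1, hχ0, -⟩ := exists_contMDiffMap_one_nhds_of_subset_interior (n := 1) 𝓘(ℝ, E3)
    hK.isClosed hKL
  have hχs : ContDiff ℝ 1 χ := (contMDiff_iff_contDiff.1 χ.contMDiff).of_le (by simp)
  have hts : tsupport (fun y => χ y * h y) ⊆ L := by
    refine closure_minimal (fun y hy => ?_) hL.isClosed
    by_contra hyL
    exact hy (by simp [hχ0 y hyL])
  refine ⟨fun y => χ y * h y, ?_, HasCompactSupport.of_support_subset_isCompact hL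
    (subset_closure.trans hts), fun y hy => ?_⟩
  · exact contDiff_of_contDiffOn_of_tsupport_subset hU (hχs.contDiffOn.mul hh) (hts.trans hLU)
  · have := hχ1.filter_mono (nhds_le_nhdsSet hy)
    filter_upwards [this] with z hz
    simp [hz]

/-- The Jacobian determinant of three functions of class `C¹`, one of which has compact support,
integrates to zero. -/
theorem integral_jac_eq_zero {U : Set E3} (hU : IsOpen U) {θ v w : E3 → ℝ}
    (hθ : ContDiffOn ℝ 1 θ U) (hc : HasCompactSupport θ) (hθU : tsupport θ ⊆ U)
    (hv : ContDiffOn ℝ 1 v U) (hw : ContDiffOn ℝ 1 w U) : ∫ y, jac θ v w y = 0 := by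
  obtain ⟨v', hv', hvc, hvv⟩ := exists_contDiff_hasCompactSupport_eventuallyEq hU hc hθU hv
  obtain ⟨w', hw', hwc, hww⟩ := exists_contDiff_hasCompactSupport_eventuallyEq hU hc hθU hw
  rw [← integral_jac_eq_zero_of_hasCompactSupport
    (contDiff_of_contDiffOn_of_tsupport_subset hU hθ hθU) hc hv' hvc hw' hwc]
  congr 1
  ext y
  by_cases hy : y ∈ tsupport θ
  · exact (jac_congr EventuallyEq.rfl (hvv y hy) (hww y hy)).symm
  · rw [jac_eq_zero_of_notMem_tsupport hy, jac_eq_zero_of_notMem_tsupport hy]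

lemma integrable_jac {U : Set E3} (hU : IsOpen U) {θ v w : E3 → ℝ}
    (hθ : ContDiffOn ℝ 1 θ U) (hc : HasCompactSupport θ) (hθU : tsupport θ ⊆ U)
    (hv : ContDiffOn ℝ 1 v U) (hw : ContDiffOn ℝ 1 w U) : Integrable (jac θ v w) := by
  have hs : Function.support (jac θ v w) ⊆ tsupport θ := fun y hy => by
    by_contra h
    exact hy (jac_eq_zero_of_notMem_tsupport h v w)
  have hcont := continuousOn_jac hU hθ hv hw
  rw [← integrableOn_iff_integrable_of_support_subset hs]
  exact (hcont.mono hθU).integrableOn_compact hc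

end Integrals

/-! ### Determinants and frames in `ℝ⁴`. -/

section LinearAlgebra

/-- The determinant of four vectors of `ℝ⁴`. -/
def det4 (a b c d : E4) : ℝ := (Matrix.of ![a.ofLp, b.ofLp, c.ofLp, d.ofLp]).det

lemma det4_eq (a b c d : E4) : det4 a b c d =
    a 0 * (b 1 * (c 2 * d 3 - c 3 * d 2) - b 2 * (c 1 * d 3 - c 3 * d 1)
      + b 3 * (c 1 * d 2 - c 2 * d 1)) -
    a 1 * (b 0 * (c 2 * d 3 - c 3 * d 2) - b 2 * (c 0 * d 3 - c 3 * d 0)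
      + b 3 * (c 0 * d 2 - c 2 * d 0)) +
    a 2 * (b 0 * (c 1 * d 3 - c 3 * d 1) - b 1 * (c 0 * d 3 - c 3 * d 0)
      + b 3 * (c 0 * d 1 - c 1 * d 0)) -
    a 3 * (b 0 * (c 1 * d 2 - c 2 * d 1) - b 1 * (c 0 * d 2 - c 2 * d 0)
      + b 2 * (c 0 * d 1 - c 1 * d 0)) := by
  simp [det4, Matrix.det_succ_row_zero, Fin.sum_univ_succ, Fin.succAbove]
  ring

/-- The determinant of four linear combinations of four vectors. -/
lemma det4_linear_comb (e0 e1 e2 e3 : E4) (a b c d : Fin 4 → ℝ) :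
    det4 (a 0 • e0 + a 1 • e1 + a 2 • e2 + a 3 • e3) (b 0 • e0 + b 1 • e1 + b 2 • e2 + b 3 • e3)
      (c 0 • e0 + c 1 • e1 + c 2 • e2 + c 3 • e3) (d 0 • e0 + d 1 • e1 + d 2 • e2 + d 3 • e3) =
    det4 (WithLp.toLp 2 a) (WithLp.toLp 2 b) (WithLp.toLp 2 c) (WithLp.toLp 2 d) *
      det4 e0 e1 e2 e3 := by
  unfold det4
  rw [← Matrix.det_mul]
  congr 1
  ext i j
  fin_cases i <;> simp [Matrix.mul_apply, Fin.sum_univ_four]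

lemma inner_E4 (v w : E4) : inner ℝ v w = v 0 * w 0 + v 1 * w 1 + v 2 * w 2 + v 3 * w 3 := by
  simp [PiLp.inner_apply, Fin.sum_univ_four]; ring

/-- Resolves the last two slots into components, so that `det(X, ν, dα, dβ)` becomes a combination
of scalar 2-forms `dα_a ∧ dβ_b`, to which the Jacobian lemmas apply. -/
lemma det4_single_sum (x y u v : E4) :
    ∑ a, ∑ b, det4 x y (EuclideanSpace.single a 1) (EuclideanSpace.single b 1) * (u a * v b) =
      det4 x y u v := by
  simp only [det4_eq, Fin.sum_univ_four]
  simp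
  ring

lemma cross_apply (a b c : E4) (k : Fin 4) :
    cross a b c k = det4 a b c (EuclideanSpace.single k 1) := rfl

lemma inner_cross (a b c w : E4) : inner ℝ (cross a b c) w = det4 a b c w := by
  rw [inner_E4]
  simp only [cross_apply, det4_eq]
  simp
  ring

/-- The Gram determinant identity; it identifies the length of the vector product of the coordinate
fields with the Riemannian volume factor. -/
lemma inner_cross_self (a b c : E4) : inner ℝ (cross a b c) (cross a b c) =
    (Matrix.of ![![inner ℝ a a, inner ℝ a b, inner ℝ a c], ![inner ℝ b a, inner ℝ b b, inner ℝ b c],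
      ![inner ℝ c a, inner ℝ c b, inner ℝ c c]]).det := by
  simp only [Matrix.det_fin_three, inner_E4, cross_apply, det4_eq]
  simp
  ring

lemma eq_zero_of_inner_eq_zero {a b c d w : E4} (h : det4 a b c d ≠ 0) (ha : inner ℝ a w = 0)
    (hb : inner ℝ b w = 0) (hc : inner ℝ c w = 0) (hd : inner ℝ d w = 0) : w = 0 := by
  have : w.ofLp = 0 := by
    refine Matrix.eq_zero_of_mulVec_eq_zero h ?_
    rw [inner_E4] at *
    ext i
    fin_cases i <;> simp [Matrix.mulVec, dotProduct, Fin.sum_univ_four] <;> assumption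
  ext i; simp [this]

/-- Decomposition of a vector of `ℝ⁴` in a frame consisting of three vectors and a unit normal. -/
lemma eq_sum_smul_add_inner_smul {e : Fin 3 → E4} {ν : E4} {G : Matrix (Fin 3) (Fin 3) ℝ}
    (hG : ∀ i j, G i j = inner ℝ (e i) (e j)) (hdet : G.det ≠ 0) (hν : inner ℝ ν ν = (1 : ℝ))
    (hνe : ∀ i, inner ℝ (e i) ν = (0 : ℝ)) (hD : det4 (e 0) (e 1) (e 2) ν ≠ 0) (w : E4) :
    w = ∑ k, (∑ j, G⁻¹ k j * inner ℝ (e j) w) • e k + inner ℝ ν w • ν := by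
  have hGG : ∀ i j, ∑ k, G i k * G⁻¹ k j = if i = j then 1 else 0 := fun i j => by
    rw [← Matrix.mul_apply, Matrix.mul_nonsing_inv _ (Ne.isUnit hdet), Matrix.one_apply]
  have hνe' : ∀ i, inner ℝ ν (e i) = (0 : ℝ) := fun i => by rw [real_inner_comm]; exact hνe i
  have he : ∀ i, inner ℝ (e i)
      (w - (∑ k, (∑ j, G⁻¹ k j * inner ℝ (e j) w) • e k + inner ℝ ν w • ν)) = (0 : ℝ) := by
    intro i
    rw [inner_sub_right, inner_add_right, inner_sum, inner_smul_right, hνe, mul_zero, add_zero]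
    simp only [inner_smul_right, ← hG, Finset.sum_mul]
    rw [Finset.sum_comm]
    have : ∀ j, ∑ k, G⁻¹ k j * inner ℝ (e j) w * G i k =
        inner ℝ (e j) w * if i = j then 1 else 0 := fun j => by
      rw [← hGG, Finset.mul_sum]; exact Finset.sum_congr rfl fun k _ => by ring
    simp [this]
  refine sub_eq_zero.1 (eq_zero_of_inner_eq_zero hD (he 0) (he 1) (he 2) ?_)
  rw [inner_sub_right, inner_add_right, inner_sum, inner_smul_right, hν]
  simp [inner_smul_right, hνe']

end LinearAlgebra

/-! ### Local hypersurface geometry: normal, second fundamental form, Weingarten equation. -/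

/-- A parametrized immersed hypersurface of class `C²`. -/
structure IsLocalImmersion (F : E3 → E4) (U : Set E3) : Prop where
  isOpen : IsOpen U
  contDiffOn : ContDiffOn ℝ 2 F U
  det_ne_zero : ∀ y ∈ U, (firstForm F y).det ≠ 0

namespace IsLocalImmersion

variable {F : E3 → E4} {U : Set E3} {y : E3}

lemma normal_sq (F : E3 → E4) (y : E3) :
    inner ℝ (cross (pd 0 F y) (pd 1 F y) (pd 2 F y)) (cross (pd 0 F y) (pd 1 F y) (pd 2 F y)) =
      (firstForm F y).det := by
  rw [inner_cross_self]
  congr 1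
  ext i j
  fin_cases i <;> fin_cases j <;> rfl

lemma norm_cross_eq (F : E3 → E4) (y : E3) :
    ‖cross (pd 0 F y) (pd 1 F y) (pd 2 F y)‖ = √(firstForm F y).det := by
  rw [← normal_sq, real_inner_self_eq_norm_sq, Real.sqrt_sq (norm_nonneg _)]

variable (hF : IsLocalImmersion F U)
include hF

lemma det_pos (hy : y ∈ U) : 0 < (firstForm F y).det := by
  refine lt_of_le_of_ne ?_ (hF.det_ne_zero y hy).symm
  rw [← normal_sq]; exact real_inner_self_nonneg

lemma sqrt_det_pos (hy : y ∈ U) : 0 < √(firstForm F y).det := Real.sqrt_pos.2 (hF.det_pos hy)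

lemma inner_unitNormal_self (hy : y ∈ U) :
    inner ℝ (unitNormal F y) (unitNormal F y) = (1 : ℝ) := by
  have h := (hF.sqrt_det_pos hy).ne'
  unfold unitNormal
  rw [inner_smul_left, inner_smul_right, normal_sq, norm_cross_eq]
  have h2 := Real.mul_self_sqrt (hF.det_pos hy).le
  simp only [RCLike.conj_to_real]
  rw [← mul_assoc, ← mul_inv, h2, inv_mul_cancel₀ (hF.det_ne_zero y hy)]

lemma det4_unitNormal (hy : y ∈ U) :
    det4 (pd 0 F y) (pd 1 F y) (pd 2 F y) (unitNormal F y) = √(firstForm F y).det := by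
  have h := (hF.sqrt_det_pos hy).ne'
  rw [← inner_cross, unitNormal, inner_smul_right, normal_sq, norm_cross_eq, inv_mul_eq_div,
    Real.div_sqrt]

omit hF in
lemma inner_pd_unitNormal (F : E3 → E4) (y : E3) (i : Fin 3) :
    inner ℝ (pd i F y) (unitNormal F y) = (0 : ℝ) := by
  have : ∀ w, inner ℝ w (cross (pd 0 F y) (pd 1 F y) (pd 2 F y)) =
    det4 (pd 0 F y) (pd 1 F y) (pd 2 F y) w := fun w => by rw [real_inner_comm, inner_cross]
  rw [unitNormal, inner_smul_right, this, det4_eq]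
  fin_cases i <;> (simp; right; ring)

lemma decomp (hy : y ∈ U) (w : E4) :
    w = ∑ k, (∑ j, (firstForm F y)⁻¹ k j * inner ℝ (pd j F y) w) • pd k F y +
      inner ℝ (unitNormal F y) w • unitNormal F y :=
  eq_sum_smul_add_inner_smul (e := fun i => pd i F y) (fun _ _ => rfl) (hF.det_ne_zero y hy)
    (hF.inner_unitNormal_self hy) (inner_pd_unitNormal F y)
    (by simpa only [hF.det4_unitNormal hy] using (hF.sqrt_det_pos hy).ne') w

lemma contDiffAt (hy : y ∈ U) : ContDiffAt ℝ 2 F y :=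
  hF.contDiffOn.contDiffAt (hF.isOpen.mem_nhds hy)

lemma contDiffOn_pd (i : Fin 3) : ContDiffOn ℝ 1 (pd i F) U :=
  Hypersurface.contDiffOn_pd hF.isOpen hF.contDiffOn (by norm_num) i

lemma differentiableAt (hy : y ∈ U) : DifferentiableAt ℝ F y :=
  (hF.contDiffAt hy).differentiableAt (by norm_num)

lemma differentiableAt_pd (hy : y ∈ U) (i : Fin 3) : DifferentiableAt ℝ (pd i F) y :=
  ((hF.contDiffOn_pd i).contDiffAt (hF.isOpen.mem_nhds hy)).differentiableAt (by norm_num)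

lemma contDiffOn_unitNormal : ContDiffOn ℝ 1 (unitNormal F) U := by
  have h : ∀ i a, ContDiffOn ℝ 1 (fun z => pd i F z a) U := fun i a =>
    (contDiffOn_piLp 2).1 (hF.contDiffOn_pd i) a
  have hc : ContDiffOn ℝ 1 (fun z => cross (pd 0 F z) (pd 1 F z) (pd 2 F z)) U := by
    rw [contDiffOn_piLp]
    intro k
    simp only [cross_apply, det4_eq]
    have h0 := h 0; have h1 := h 1; have h2 := h 2
    fun_prop
  refine ContDiffOn.smul (ContDiffOn.inv (hc.norm ℝ fun z hz => ?_) fun z hz => ?_) hc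
  · rw [← norm_ne_zero_iff, norm_cross_eq]; exact (hF.sqrt_det_pos hz).ne'
  · rw [norm_cross_eq]; exact (hF.sqrt_det_pos hz).ne'

lemma differentiableAt_unitNormal (hy : y ∈ U) : DifferentiableAt ℝ (unitNormal F) y :=
  (hF.contDiffOn_unitNormal.contDiffAt (hF.isOpen.mem_nhds hy)).differentiableAt (by norm_num)

lemma secondForm_symm (hy : y ∈ U) (i j : Fin 3) : secondForm F y i j = secondForm F y j i := by
  simp only [secondForm, Matrix.of_apply]
  rw [pd_comm (hF.contDiffAt hy)]

lemma inner_pd_pd_unitNormal (hy : y ∈ U) (i j : Fin 3) :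
    inner ℝ (pd j F y) (pd i (unitNormal F) y) = -secondForm F y i j := by
  have h : pd i (fun z => inner ℝ (pd j F z) (unitNormal F z)) y = 0 := by
    simp only [inner_pd_unitNormal]; exact pd_const i 0 y
  rw [pd_inner (hF.differentiableAt_pd hy j) (hF.differentiableAt_unitNormal hy)] at h
  simp only [secondForm, Matrix.of_apply]
  linarith

lemma inner_unitNormal_pd_unitNormal (hy : y ∈ U) (i : Fin 3) :
    inner ℝ (unitNormal F y) (pd i (unitNormal F) y) = (0 : ℝ) := by
  have h : pd i (fun z => inner ℝ (unitNormal F z) (unitNormal F z)) y = 0 := by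
    rw [← pd_const i (1 : ℝ) y]
    refine pd_congr ?_
    filter_upwards [hF.isOpen.mem_nhds hy] with z hz using hF.inner_unitNormal_self hz
  rw [pd_inner (hF.differentiableAt_unitNormal hy) (hF.differentiableAt_unitNormal hy),
    real_inner_comm] at h
  linarith

/-- The Weingarten equation. -/
lemma pd_unitNormal (hy : y ∈ U) (i : Fin 3) : pd i (unitNormal F) y =
    ∑ k, (-((firstForm F y)⁻¹ * secondForm F y) k i) • pd k F y := by
  conv_lhs => rw [hF.decomp hy (pd i (unitNormal F) y)]
  rw [hF.inner_unitNormal_pd_unitNormal hy, zero_smul, add_zero]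
  refine Finset.sum_congr rfl fun k _ => ?_
  congr 1
  simp only [hF.inner_pd_pd_unitNormal hy, Matrix.mul_apply, ← Finset.sum_neg_distrib]
  exact Finset.sum_congr rfl fun j _ => by rw [hF.secondForm_symm hy i j]; ring

end IsLocalImmersion

/-! ### Exterior derivatives of the forms `f det(X, ν, dα, dβ)`. -/

section FormDensity

lemma det4_expand (x y u v : E4) : det4 x y u v =
    ∑ k, ∑ l, x k * y l * det4 (EuclideanSpace.single k 1) (EuclideanSpace.single l 1) u v := by
  simp only [det4_eq, Fin.sum_univ_four]
  simp
  ring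

lemma pd_det4 {X ν : E3 → E4} {y : E3} (hX : DifferentiableAt ℝ X y)
    (hν : DifferentiableAt ℝ ν y) (i : Fin 3) (u v : E4) :
    pd i (fun z => det4 (X z) (ν z) u v) y =
      det4 (pd i X y) (ν y) u v + det4 (X y) (pd i ν y) u v := by
  have h : ∀ a, DifferentiableAt ℝ (fun z => X z a) y := (differentiableAt_piLp 2).1 hX
  have h' : ∀ a, DifferentiableAt ℝ (fun z => ν z a) y := (differentiableAt_piLp 2).1 hν
  have hm : ∀ k l, DifferentiableAt ℝ (fun z => X z k * ν z l *
      det4 (EuclideanSpace.single k 1) (EuclideanSpace.single l 1) u v) y :=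
    fun k l => ((h k).mul (h' l)).mul_const _
  rw [det4_expand (pd i X y), det4_expand (X y) (pd i ν y),
    show (fun z => det4 (X z) (ν z) u v) = _ from funext fun z => det4_expand (X z) (ν z) u v]
  rw [pd_sum fun k _ => DifferentiableAt.fun_sum fun l _ => hm k l, ← Finset.sum_add_distrib]
  refine Finset.sum_congr rfl fun k _ => ?_
  rw [pd_sum fun l _ => hm k l, ← Finset.sum_add_distrib]
  refine Finset.sum_congr rfl fun l _ => ?_
  have hkl : DifferentiableAt ℝ (fun z => X z k * ν z l) y := (h k).mul (h' l)
  rw [pd_mul hkl (by fun_prop), pd_mul (h k) (h' l), pd_const,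
    pd_apply hX, pd_apply hν]
  ring

lemma differentiableAt_det4 {X ν : E3 → E4} {y : E3} (hX : DifferentiableAt ℝ X y)
    (hν : DifferentiableAt ℝ ν y) (u v : E4) :
    DifferentiableAt ℝ (fun z => det4 (X z) (ν z) u v) y := by
  have h : ∀ a, DifferentiableAt ℝ (fun z => X z a) y := (differentiableAt_piLp 2).1 hX
  have h' : ∀ a, DifferentiableAt ℝ (fun z => ν z a) y := (differentiableAt_piLp 2).1 hν
  simp only [det4_eq]
  fun_prop

lemma contDiffOn_det4 {U : Set E3} {n : ℕ∞ω} {X ν : E3 → E4} (hX : ContDiffOn ℝ n X U)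
    (hν : ContDiffOn ℝ n ν U) (u v : E4) : ContDiffOn ℝ n (fun z => det4 (X z) (ν z) u v) U := by
  have h : ∀ a, ContDiffOn ℝ n (fun z => X z a) U := (contDiffOn_piLp 2).1 hX
  have h' : ∀ a, ContDiffOn ℝ n (fun z => ν z a) U := (contDiffOn_piLp 2).1 hν
  simp only [det4_eq]
  fun_prop

/-- The density, with respect to the standard volume form of `ℝ³`, of the exterior derivative of
the 2-form `f det (X, ν, dα, dβ)`. -/
def formDensity (f : E3 → ℝ) (X ν α β : E3 → E4) (y : E3) : ℝ :=
  ∑ a, ∑ b, jac (fun z => f z * det4 (X z) (ν z) (EuclideanSpace.single a 1)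
    (EuclideanSpace.single b 1)) (fun z => α z a) (fun z => β z b) y

variable {U : Set E3} {f : E3 → ℝ} {X ν α β : E3 → E4} {y : E3}

/-- The product rule, antisymmetrized over the three coordinate directions. No second derivatives of
`α` and `β` occur, which reflects `d(dα) = d(dβ) = 0` and keeps the formula valid for maps that are
merely differentiable. Passing `T` through an equation lets it be inferred by `rfl`. -/
lemma formDensity_eq (hf : DifferentiableAt ℝ f y) (hX : DifferentiableAt ℝ X y)
    (hν : DifferentiableAt ℝ ν y) (hα : DifferentiableAt ℝ α y) (hβ : DifferentiableAt ℝ β y)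
    {T : Fin 3 → Fin 3 → Fin 3 → ℝ}
    (hT : ∀ i j k, T i j k = pd i f y * det4 (X y) (ν y) (pd j α y) (pd k β y) +
      f y * (det4 (pd i X y) (ν y) (pd j α y) (pd k β y) +
        det4 (X y) (pd i ν y) (pd j α y) (pd k β y))) :
    formDensity f X ν α β y = (T 0 1 2 - T 0 2 1) + (T 1 2 0 - T 1 0 2) + (T 2 0 1 - T 2 1 0) := by
  have hc := differentiableAt_det4 hX hν
  have key : ∀ i j k, ∑ a, ∑ b, pd i (fun z => f z * det4 (X z) (ν z) (EuclideanSpace.single a 1)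
      (EuclideanSpace.single b 1)) y * (pd j α y a * pd k β y b) = T i j k := by
    intro i j k
    rw [hT, ← det4_single_sum (X y) (ν y), ← det4_single_sum (pd i X y), ← det4_single_sum (X y)]
    simp only [Finset.mul_sum, ← Finset.sum_add_distrib]
    refine Finset.sum_congr rfl fun a _ => Finset.sum_congr rfl fun b _ => ?_
    rw [pd_mul hf (hc _ _), pd_det4 hX hν]
    ring
  simp only [← key, formDensity, ← Finset.sum_sub_distrib, ← Finset.sum_add_distrib]
  refine Finset.sum_congr rfl fun a _ => Finset.sum_congr rfl fun b _ => ?_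
  simp only [jac_eq, pd_apply hα, pd_apply hβ]
  ring

lemma formDensity_congr {f' : E3 → ℝ} {X' ν' α' β' : E3 → E4} (hf : f =ᶠ[𝓝 y] f')
    (hX : X =ᶠ[𝓝 y] X') (hν : ν =ᶠ[𝓝 y] ν') (hα : α =ᶠ[𝓝 y] α') (hβ : β =ᶠ[𝓝 y] β') :
    formDensity f X ν α β y = formDensity f' X' ν' α' β' y := by
  unfold formDensity
  refine Finset.sum_congr rfl fun a _ => Finset.sum_congr rfl fun b _ => jac_congr ?_ ?_ ?_
  · filter_upwards [hf, hX, hν] with z h1 h2 h3; rw [h1, h2, h3]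
  · filter_upwards [hα] with z h; rw [h]
  · filter_upwards [hβ] with z h; rw [h]

lemma continuousOn_formDensity (hU : IsOpen U) (hf : ContDiffOn ℝ 1 f U) (hX : ContDiffOn ℝ 1 X U)
    (hν : ContDiffOn ℝ 1 ν U) (hα : ContDiffOn ℝ 1 α U) (hβ : ContDiffOn ℝ 1 β U) :
    ContinuousOn (formDensity f X ν α β) U :=
  continuousOn_finsetSum _ fun a _ => continuousOn_finsetSum _ fun b _ =>
    continuousOn_jac hU (hf.mul (contDiffOn_det4 hX hν _ _)) ((contDiffOn_piLp 2).1 hα a)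
      ((contDiffOn_piLp 2).1 hβ b)

lemma integral_formDensity (hU : IsOpen U) (hf : ContDiffOn ℝ 1 f U) (hc : HasCompactSupport f)
    (hfU : tsupport f ⊆ U) (hX : ContDiffOn ℝ 1 X U)
    (hν : ContDiffOn ℝ 1 ν U) (hα : ContDiffOn ℝ 1 α U) (hβ : ContDiffOn ℝ 1 β U) :
    Integrable (formDensity f X ν α β) ∧ ∫ y, formDensity f X ν α β y = 0 := by
  have h1 : ∀ a b : Fin 4, ContDiffOn ℝ 1 (fun z => f z * det4 (X z) (ν z)
      (EuclideanSpace.single a 1) (EuclideanSpace.single b 1)) U :=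
    fun a b => hf.mul (contDiffOn_det4 hX hν _ _)
  have h2 : ∀ a b : Fin 4, HasCompactSupport (fun z => f z * det4 (X z) (ν z)
      (EuclideanSpace.single a 1) (EuclideanSpace.single b 1)) := fun a b => hc.mul_right
  have h3 : ∀ a b : Fin 4, tsupport (fun z => f z * det4 (X z) (ν z)
      (EuclideanSpace.single a 1) (EuclideanSpace.single b 1)) ⊆ U :=
    fun a b => (tsupport_mul_subset_left (f := f)).trans hfU
  have h4 := (contDiffOn_piLp 2).1 hα
  have h5 := (contDiffOn_piLp 2).1 hβ
  have hi : ∀ a b, Integrable (jac (fun z => f z * det4 (X z) (ν z) (EuclideanSpace.single a 1)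
      (EuclideanSpace.single b 1)) (fun z => α z a) (fun z => β z b)) :=
    fun a b => integrable_jac hU (h1 a b) (h2 a b) (h3 a b) (h4 a) (h5 b)
  unfold formDensity
  refine ⟨integrable_finsetSum _ fun a _ => integrable_finsetSum _ fun b _ => hi a b, ?_⟩
  rw [integral_finsetSum _ fun a _ => integrable_finsetSum _ fun b _ => hi a b]
  refine Finset.sum_eq_zero fun a _ => ?_
  rw [integral_finsetSum _ fun b _ => hi a b]
  exact Finset.sum_eq_zero fun b _ =>
    integral_jac_eq_zero hU (h1 a b) (h2 a b) (h3 a b) (h4 a) (h5 b)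

end FormDensity

/-! ### The integrand of the integral formula in coordinates. -/

/-- The support function of the parametrized hypersurface `F`. -/
def support (F : E3 → E4) (y : E3) : ℝ := inner ℝ (F y) (unitNormal F y)

/-- The density of the exterior derivative of the 2-form
`η (det (X, ν, dX, dX) + p det (X, ν, dX, dν) + p² det (X, ν, dν, dν))`, where `X` is the position,
`ν` the unit normal and `p` the support function. -/
def density (η : E3 → ℝ) (F : E3 → E4) (y : E3) : ℝ :=
  formDensity η F (unitNormal F) F F y +
  formDensity (fun z => η z * support F z) F (unitNormal F) F (unitNormal F) y +
  formDensity (fun z => η z * support F z ^ 2) F (unitNormal F) (unitNormal F) (unitNormal F) y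

/-- The components, with respect to the coordinate frame, of the tangential part of the position
vector. -/
def tangentialCoord (F : E3 → E4) (y : E3) (k : Fin 3) : ℝ :=
  ∑ j, (firstForm F y)⁻¹ k j * inner ℝ (pd j F y) (F y)

/-- The Ricci tensor of a hypersurface, according to the Gauss equation. -/
def gaussRicci (F : E3 → E4) (y : E3) : Matrix (Fin 3) (Fin 3) ℝ :=
  ((firstForm F y)⁻¹ * secondForm F y).trace • secondForm F y -
    secondForm F y * (firstForm F y)⁻¹ * secondForm F y

namespace IsLocalImmersion

variable {F : E3 → E4} {U : Set E3} {y : E3} (hF : IsLocalImmersion F U)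
include hF

lemma contDiffOn_support : ContDiffOn ℝ 1 (support F) U :=
  (hF.contDiffOn.of_le (by norm_num)).inner ℝ hF.contDiffOn_unitNormal

lemma position_eq (hy : y ∈ U) :
    F y = ∑ k, tangentialCoord F y k • pd k F y + support F y • unitNormal F y := by
  conv_lhs => rw [hF.decomp hy (F y)]
  rw [support, real_inner_comm]; rfl

/-- Only the tangential part of the position contributes: `⟨∂ᵢF, ν⟩` vanishes, and `∂ᵢν` is
tangential. -/
lemma pd_support (hy : y ∈ U) (i : Fin 3) :
    pd i (support F) y = -∑ k, tangentialCoord F y k * secondForm F y i k := by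
  have h1 : pd i (support F) y = inner ℝ (F y) (pd i (unitNormal F) y) := by
    unfold support
    rw [pd_inner (hF.differentiableAt hy) (hF.differentiableAt_unitNormal hy),
      inner_pd_unitNormal, zero_add]
  rw [h1]
  conv_lhs => rw [hF.position_eq hy]
  rw [inner_add_left, inner_smul_left, hF.inner_unitNormal_pd_unitNormal hy, sum_inner]
  simp [inner_smul_left, hF.inner_pd_pd_unitNormal hy]

/-- With `S` the shape operator, `det(dX, ν, dX, dX)` gives the 6. The normal part of `X` in `det(X,
dν, dX, dX)` gives a multiple of `p tr S`, cancelled by `p det(dX, ν, dX, dν)`; the terms in `p²`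
times the second symmetric function of `S` cancel likewise between the second and third forms. The
last form leaves `6p³K`. The differential of `p`, which is minus the second fundamental form applied
to `T`, yields `Ric(T,T)` in the second form and, by `S adj(S) = K`, the term `-4pK|T|²` in the
third. -/
lemma density_one (hy : y ∈ U) : density (fun _ => 1) F y = √(firstForm F y).det *
    (6 + tangentialCoord F y ⬝ᵥ (gaussRicci F y *ᵥ tangentialCoord F y) +
      2 * support F y * gaussKroneckerCoord F y * (3 * support F y ^ 2 -
        2 * (tangentialCoord F y ⬝ᵥ (firstForm F y *ᵥ tangentialCoord F y)))) := by
  have hFd := hF.differentiableAt hy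
  have hνd := hF.differentiableAt_unitNormal hy
  have hpd : DifferentiableAt ℝ (support F) y :=
    (hF.contDiffOn_support.contDiffAt (hF.isOpen.mem_nhds hy)).differentiableAt (by norm_num)
  have hG := hF.det_ne_zero y hy
  have hD := hF.det4_unitNormal hy
  have hX := hF.position_eq hy
  have hW := hF.pd_unitNormal hy
  have hp := hF.pd_support hy
  have hp2 : ∀ i, pd i (fun z => support F z ^ 2) y = 2 * support F y * pd i (support F) y := by
    intro i
    simp only [pow_two]
    rw [pd_mul hpd hpd]; ring
  have hh : secondForm F y = firstForm F y * ((firstForm F y)⁻¹ * secondForm F y) := by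
    rw [← Matrix.mul_assoc, Matrix.mul_nonsing_inv _ (Ne.isUnit hG), one_mul]
  have hhsymm := hF.secondForm_symm hy
  have hgR : gaussRicci F y = ((firstForm F y)⁻¹ * secondForm F y).trace • secondForm F y -
    secondForm F y * ((firstForm F y)⁻¹ * secondForm F y) := by
    rw [gaussRicci, Matrix.mul_assoc]
  have hK : gaussKroneckerCoord F y = ((firstForm F y)⁻¹ * secondForm F y).det := rfl
  simp only [density, one_mul]
  rw [formDensity_eq (by fun_prop) hFd hνd hFd hFd (fun _ _ _ => rfl),
    formDensity_eq hpd hFd hνd hFd hνd (fun _ _ _ => rfl),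
    formDensity_eq (by fun_prop) hFd hνd hνd hνd (fun _ _ _ => rfl)]
  simp only [hp2, pd_const]
  rw [← hD, hgR, hK]
  -- With the indices of the second form in this order and `h = G S` substituted below, the claim is
  -- a polynomial identity in the entries of `G`, `S`, `n` and `p`; neither symmetry nor the inverse
  -- matrix is needed any more.
  have hp' : ∀ i, pd i (support F) y = -∑ k, tangentialCoord F y k * secondForm F y k i :=
    fun i => by rw [hp]; simp only [hhsymm i]
  simp only [hp']
  generalize (firstForm F y)⁻¹ * secondForm F y = S at *
  generalize secondForm F y = h at *
  generalize firstForm F y = G at *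
  subst hh
  generalize tangentialCoord F y = n at *
  generalize support F y = p at *
  -- `c` sends coefficients in the frame `(∂₀F, ∂₁F, ∂₂F, ν)` to the vector. Keeping it opaque
  -- reduces every determinant to one of coefficients times that of the frame.
  obtain ⟨c, hc, h0, h1, h2, h3, hcX, hc0, hc1, hc2⟩ : ∃ c : (Fin 4 → ℝ) → E4,
      (∀ a₁ a₂ a₃ a₄, det4 (c a₁) (c a₂) (c a₃) (c a₄) = det4 (WithLp.toLp 2 a₁)
        (WithLp.toLp 2 a₂) (WithLp.toLp 2 a₃) (WithLp.toLp 2 a₄) *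
        det4 (pd 0 F y) (pd 1 F y) (pd 2 F y) (unitNormal F y)) ∧
      pd 0 F y = c ![1, 0, 0, 0] ∧ pd 1 F y = c ![0, 1, 0, 0] ∧ pd 2 F y = c ![0, 0, 1, 0] ∧
      unitNormal F y = c ![0, 0, 0, 1] ∧ F y = c ![n 0, n 1, n 2, p] ∧
      pd 0 (unitNormal F) y = c ![-S 0 0, -S 1 0, -S 2 0, 0] ∧
      pd 1 (unitNormal F) y = c ![-S 0 1, -S 1 1, -S 2 1, 0] ∧
      pd 2 (unitNormal F) y = c ![-S 0 2, -S 1 2, -S 2 2, 0] := by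
    refine ⟨fun a => a 0 • pd 0 F y + a 1 • pd 1 F y + a 2 • pd 2 F y + a 3 • unitNormal F y,
      fun _ _ _ _ => det4_linear_comb _ _ _ _ _ _ _ _, ?_⟩
    simp only [hW, hX, Fin.sum_univ_three]
    simp
  generalize det4 (pd 0 F y) (pd 1 F y) (pd 2 F y) (unitNormal F y) = δ at *
  simp only [h0, h1, h2, h3, hcX, hc0, hc1, hc2, hc, det4_eq, Fin.sum_univ_three,
    Matrix.mul_apply, Matrix.det_fin_three, Matrix.trace_fin_three, dotProduct, Matrix.mulVec,
    Matrix.sub_apply, Matrix.smul_apply, smul_eq_mul]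
  simp only [Matrix.cons_val]
  ring

end IsLocalImmersion

/-! ### The Gauss equation for immersions of class `C²`. -/

lemma pd_coordinate (i m : Fin 3) (y : E3) :
    pd i (fun z => z m) y = if i = m then 1 else 0 := by
  have : pd i (fun z : E3 => z m) y = (stdVec i) m :=
    congrArg (fun L : E3 →L[ℝ] ℝ => L (stdVec i))
      (EuclideanSpace.proj (𝕜 := ℝ) m : E3 →L[ℝ] ℝ).fderiv
  rw [this, stdVec, PiLp.single_apply]
  simp [eq_comm]

/-- The weak form of `∂ₖ∂ⱼv = ∂ⱼ∂ₖv`, available for `v` of class `C¹`: it is the vanishing of the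
integral of a Jacobian whose third function is a coordinate. -/
lemma integral_pd_mul_pd_sub {U : Set E3} (hU : IsOpen U) {θ v : E3 → ℝ}
    (hθ : ContDiffOn ℝ 1 θ U) (hc : HasCompactSupport θ) (hθU : tsupport θ ⊆ U)
    (hv : ContDiffOn ℝ 1 v U) (k j : Fin 3) :
    Integrable (fun y => pd k θ y * pd j v y - pd j θ y * pd k v y) ∧
      ∫ y, (pd k θ y * pd j v y - pd j θ y * pd k v y) = 0 := by
  have hx : ∀ m : Fin 3, ContDiffOn ℝ 1 (fun z : E3 => z m) U := fun m =>
    (EuclideanSpace.proj (𝕜 := ℝ) m : E3 →L[ℝ] ℝ).contDiff.contDiffOn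
  have key : ∀ m, Integrable (jac θ v (fun z => z m)) ∧ ∫ y, jac θ v (fun z => z m) y = 0 :=
    fun m => ⟨integrable_jac hU hθ hc hθU hv (hx m), integral_jac_eq_zero hU hθ hc hθU hv (hx m)⟩
  have key' : ∀ m, Integrable (fun y => -jac θ v (fun z => z m) y) ∧
      ∫ y, -jac θ v (fun z => z m) y = 0 := fun m =>
    ⟨(key m).1.neg, by rw [integral_neg, (key m).2, neg_zero]⟩
  have e0 : jac θ v (fun z => z 0) = fun y => pd 1 θ y * pd 2 v y - pd 2 θ y * pd 1 v y := by
    ext y; simp [jac_eq, pd_coordinate]; ring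
  have e1 : jac θ v (fun z => z 1) = fun y => pd 2 θ y * pd 0 v y - pd 0 θ y * pd 2 v y := by
    ext y; simp [jac_eq, pd_coordinate]; ring
  have e2 : jac θ v (fun z => z 2) = fun y => pd 0 θ y * pd 1 v y - pd 1 θ y * pd 0 v y := by
    ext y; simp [jac_eq, pd_coordinate]; ring
  have k0 := key 0; have k1 := key 1; have k2 := key 2
  have k0' := key' 0; have k1' := key' 1; have k2' := key' 2
  simp only [e0, e1, e2, neg_sub] at k0 k1 k2 k0' k1' k2'
  fin_cases k <;> fin_cases j <;> first | (simp; done) | assumption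

section Congr

variable {G G' : E3 → Matrix (Fin 3) (Fin 3) ℝ} {y : E3}

lemma christoffel_congr (h : G =ᶠ[𝓝 y] G') (k i j : Fin 3) :
    christoffel G k i j =ᶠ[𝓝 y] christoffel G' k i j := by
  have hp : ∀ a i j, pd a (fun z => G z i j) =ᶠ[𝓝 y] pd a (fun z => G' z i j) := fun a i j =>
    pd_eventuallyEq (by filter_upwards [h] with z hz; rw [hz])
  have h1 : ∀ᶠ z in 𝓝 y, ∀ a i j, pd a (fun z => G z i j) z = pd a (fun z => G' z i j) z := by
    simp only [eventually_all]; exact hp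
  filter_upwards [h, h1] with z hz hz1
  simp only [christoffel, hz, hz1]

lemma ricciCoeff_congr (h : G =ᶠ[𝓝 y] G') (i j : Fin 3) :
    ricciCoeff G i j y = ricciCoeff G' i j y := by
  have h1 := fun k i j => christoffel_congr h k i j
  simp only [ricciCoeff, pd_congr (h1 _ _ _), (h1 _ _ _).eq_of_nhds]

end Congr

namespace IsLocalImmersion

variable {F : E3 → E4} {U : Set E3} {y : E3} (hF : IsLocalImmersion F U)
include hF

lemma pd_firstForm (hy : y ∈ U) (k i j : Fin 3) : pd k (fun z => firstForm F z i j) y =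
    inner ℝ (pd k (pd i F) y) (pd j F y) + inner ℝ (pd k (pd j F) y) (pd i F y) := by
  simp only [firstForm, Matrix.of_apply]
  rw [pd_inner (hF.differentiableAt_pd hy i) (hF.differentiableAt_pd hy j),
    real_inner_comm (pd k (pd j F) y)]

/-- Koszul's formula: the symmetry of the second derivatives lets the derivatives of the metric be
solved for these products. -/
lemma inner_pd_pd_eq (hy : y ∈ U) (i j l : Fin 3) :
    inner ℝ (pd i (pd j F) y) (pd l F y) = (1 / 2) * (pd i (fun z => firstForm F z j l) y +
      pd j (fun z => firstForm F z i l) y - pd l (fun z => firstForm F z i j) y) := by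
  simp only [hF.pd_firstForm hy]
  rw [pd_comm (hF.contDiffAt hy) j i, pd_comm (hF.contDiffAt hy) l i,
    pd_comm (hF.contDiffAt hy) l j]
  ring

lemma christoffel_eq (hy : y ∈ U) (k i j : Fin 3) : christoffel (firstForm F) k i j y =
    ∑ l, (firstForm F y)⁻¹ k l * inner ℝ (pd l F y) (pd i (pd j F) y) := by
  rw [christoffel, Finset.mul_sum]
  refine Finset.sum_congr rfl fun l _ => ?_
  rw [real_inner_comm, hF.inner_pd_pd_eq hy]
  ring

/-- The Gauss formula. -/
lemma pd_pd_eq (hy : y ∈ U) (i j : Fin 3) : pd i (pd j F) y =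
    ∑ k, christoffel (firstForm F) k i j y • pd k F y +
      secondForm F y i j • unitNormal F y := by
  conv_lhs => rw [hF.decomp hy (pd i (pd j F) y)]
  simp only [hF.christoffel_eq hy, secondForm, Matrix.of_apply]
  rw [real_inner_comm (unitNormal F y)]

lemma sum_christoffel_mul (hy : y ∈ U) (i j l : Fin 3) :
    ∑ m, christoffel (firstForm F) m i j y * firstForm F y m l =
      inner ℝ (pd i (pd j F) y) (pd l F y) := by
  conv_rhs => rw [hF.pd_pd_eq hy i j]
  rw [inner_add_left, inner_smul_left, real_inner_comm (pd l F y) (unitNormal F y),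
    inner_pd_unitNormal, mul_zero, add_zero, sum_inner]
  simp [inner_smul_left, firstForm]

variable (hG : ∀ i j, ContDiffOn ℝ 2 (fun z => firstForm F z i j) U)
include hG

/-- The second derivatives of `F` are merely continuous, but these products are Christoffel symbols
of the first kind, hence first derivatives of a `C²` metric. -/
lemma contDiffOn_inner_pd_pd (i j l : Fin 3) :
    ContDiffOn ℝ 1 (fun z => inner ℝ (pd i (pd j F) z) (pd l F z)) U := by
  have h : ∀ a i j, ContDiffOn ℝ 1 (pd a (fun z => firstForm F z i j)) U := fun a i j =>
    Hypersurface.contDiffOn_pd hF.isOpen (hG i j) (by norm_num) a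
  exact (contDiffOn_const.mul (((h i j l).add (h j i l)).sub (h l i j))).congr
    fun z hz => hF.inner_pd_pd_eq hz i j l

lemma contDiffOn_christoffel (k i j : Fin 3) :
    ContDiffOn ℝ 1 (christoffel (firstForm F) k i j) U := by
  have h1 : ∀ i j, ContDiffOn ℝ 1 (fun z => firstForm F z i j) U := fun i j =>
    (hG i j).of_le (by norm_num)
  have hdet : ContDiffOn ℝ 1 (fun z => (firstForm F z).det) U := by
    simp only [Matrix.det_fin_three]
    fun_prop
  have hinv : ∀ k l, ContDiffOn ℝ 1 (fun z => (firstForm F z)⁻¹ k l) U := by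
    intro k l
    simp only [Matrix.inv_def, Ring.inverse_eq_inv', Matrix.smul_apply, smul_eq_mul]
    refine (hdet.inv hF.det_ne_zero).mul ?_
    simp only [Matrix.adjugate_fin_three]
    fin_cases k <;> fin_cases l <;> simp <;> fun_prop
  refine ContDiffOn.congr (f := fun z => ∑ l, (firstForm F z)⁻¹ k l *
    inner ℝ (pd i (pd j F) z) (pd l F z)) ?_ fun z hz => ?_
  · exact ContDiffOn.sum fun l _ => (hinv k l).mul (hF.contDiffOn_inner_pd_pd hG i j l)
  · rw [hF.christoffel_eq hz]
    exact Finset.sum_congr rfl fun l _ => by rw [real_inner_comm]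

/-- For `F` of class `C³` this is the product rule with the third derivatives cancelling. For `F` of
class `C²` the cancellation is carried out after integration against a test function. -/
lemma pd_inner_pd_pd_sub (hy : y ∈ U) (i j k l : Fin 3) :
    pd k (fun z => inner ℝ (pd i (pd j F) z) (pd l F z)) y -
      pd j (fun z => inner ℝ (pd i (pd k F) z) (pd l F z)) y =
    inner ℝ (pd i (pd j F) y) (pd k (pd l F) y) -
      inner ℝ (pd i (pd k F) y) (pd j (pd l F) y) := by
  have hU := hF.isOpen
  have hB := hF.contDiffOn_inner_pd_pd hG
  have hcB : ∀ m i j, ContinuousOn (pd m (fun z => inner ℝ (pd i (pd j F) z) (pd l F z))) U :=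
    fun m i j =>
      (Hypersurface.contDiffOn_pd (m := 0) hU (hB i j l) (by norm_num) m).continuousOn
  have hc2 : ∀ i j, ContinuousOn (pd i (pd j F)) U := fun i j =>
    (Hypersurface.contDiffOn_pd (m := 0) hU (hF.contDiffOn_pd j) (by norm_num) i).continuousOn
  have hcont : ContinuousOn (fun y => inner ℝ (pd i (pd j F) y) (pd k (pd l F) y) -
      inner ℝ (pd i (pd k F) y) (pd j (pd l F) y) -
      (pd k (fun z => inner ℝ (pd i (pd j F) z) (pd l F z)) y -
      pd j (fun z => inner ℝ (pd i (pd k F) z) (pd l F z)) y)) U :=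
    (((hc2 i j).inner (hc2 k l)).sub ((hc2 i k).inner (hc2 j l))).sub
      ((hcB k i j).sub (hcB j i k))
  -- The difference of the two sides is continuous, so vanishing against all test functions forces
  -- it to vanish at every point.
  have hae := hU.ae_eq_zero_of_integral_contDiff_smul_eq_zero
    (hcont.locallyIntegrableOn (μ := volume) hU.measurableSet) fun η hη hηc hηU => ?_
  · have h0 := Measure.eqOn_open_of_ae_eq ((ae_restrict_iff' hU.measurableSet).2 hae) hU hcont
      (continuousOn_const (c := (0 : ℝ))) hy
    simp only at h0
    linarith
  · have hη1 : ContDiff ℝ 1 η := hη.of_le (by simp)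
    have hFl : ∀ l a, ContDiffOn ℝ 1 (fun z => pd l F z a) U := fun l a =>
      (contDiffOn_piLp 2).1 (hF.contDiffOn_pd l) a
    -- For each component `a`, the weak symmetry is applied to `θ = η (∂ₗF)_a` and `v = (∂ᵢF)_a`.
    have hweak : ∀ a : Fin 4, _ := fun a => integral_pd_mul_pd_sub hU
      (hη1.contDiffOn.mul (hFl l a)) hηc.mul_right ((tsupport_mul_subset_left (f := η)).trans hηU)
      (hFl i a) k j
    have hBc : ∀ i j, ContDiff ℝ 1 (fun z => η z * inner ℝ (pd i (pd j F) z) (pd l F z)) :=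
      fun i j => contDiff_of_contDiffOn_of_tsupport_subset hU (hη1.contDiffOn.mul (hB i j l))
        ((tsupport_mul_subset_left (f := η)).trans hηU)
    have hBs : ∀ i j, HasCompactSupport (fun z => η z * inner ℝ (pd i (pd j F) z) (pd l F z)) :=
      fun i j => hηc.mul_right
    have hBi : ∀ m i j,
        Integrable (pd m fun z => η z * inner ℝ (pd i (pd j F) z) (pd l F z)) := fun m i j =>
      (contDiff_pd (m := 0) (hBc i j) (by norm_num) m).continuous.integrable_of_hasCompactSupport
        ((hBs i j).fderiv_apply ℝ _)
    -- Summed over `a`, the terms containing derivatives of `η` cancel against those of `η ⟨∂ᵢ∂ⱼF,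
    -- ∂ₗF⟩`; what remains is a sum of expressions with integral zero.
    have heq : ∀ y, η y • (inner ℝ (pd i (pd j F) y) (pd k (pd l F) y) -
        inner ℝ (pd i (pd k F) y) (pd j (pd l F) y) -
        (pd k (fun z => inner ℝ (pd i (pd j F) z) (pd l F z)) y -
        pd j (fun z => inner ℝ (pd i (pd k F) z) (pd l F z)) y)) =
        ∑ a, (pd k (fun z => η z * pd l F z a) y * pd j (fun z => pd i F z a) y -
          pd j (fun z => η z * pd l F z a) y * pd k (fun z => pd i F z a) y) -
        (pd k (fun z => η z * inner ℝ (pd i (pd j F) z) (pd l F z)) y -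
          pd j (fun z => η z * inner ℝ (pd i (pd k F) z) (pd l F z)) y) := by
      intro y
      by_cases hyη : y ∈ tsupport η
      · have hy := hηU hyη
        have hηd : DifferentiableAt ℝ η y := hη1.differentiable (by norm_num) y
        have hFd := hF.differentiableAt_pd hy
        have hFd' : ∀ a, DifferentiableAt ℝ (fun z => pd l F z a) y :=
          (differentiableAt_piLp 2).1 (hFd l)
        have hBd : ∀ i j, DifferentiableAt ℝ (fun z => inner ℝ (pd i (pd j F) z) (pd l F z)) y :=
          fun i j => ((hB i j l).contDiffAt (hU.mem_nhds hy)).differentiableAt (by norm_num)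
        simp only [pd_mul hηd (hFd' _), pd_mul hηd (hBd _ _), pd_apply (hFd _), smul_eq_mul]
        rw [pd_comm (hF.contDiffAt hy) i j, pd_comm (hF.contDiffAt hy) i k]
        simp only [Fin.sum_univ_four, inner_E4]
        ring
      · have h0 : η y = 0 := image_eq_zero_of_notMem_tsupport hyη
        have h1 : ∀ (f : E3 → ℝ) m, pd m (fun z => η z * f z) y = 0 := fun f m =>
          pd_eq_zero_of_notMem_tsupport (fun h => hyη (tsupport_mul_subset_left h)) m
        simp [h0, h1]
    simp only [heq]
    have hBB : Integrable fun y => pd k (fun z => η z * inner ℝ (pd i (pd j F) z) (pd l F z)) y -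
      pd j (fun z => η z * inner ℝ (pd i (pd k F) z) (pd l F z)) y := (hBi k i j).sub (hBi j i k)
    rw [integral_sub (integrable_finsetSum _ fun a _ => (hweak a).1) hBB,
      integral_finsetSum _ fun a _ => (hweak a).1, Finset.sum_eq_zero fun a _ => (hweak a).2,
      integral_sub (hBi k i j) (hBi j i k), integral_pd_eq_zero (hBc _ _) (hBs _ _),
      integral_pd_eq_zero (hBc _ _) (hBs _ _)]
    simp

/-- The Gauss equation for hypersurfaces of class `C²` whose first fundamental form is of
class `C²`, in contracted form. -/
theorem ricciCoeff_firstForm (hy : y ∈ U) (i j : Fin 3) :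
    ricciCoeff (firstForm F) i j y = gaussRicci F y i j := by
  have hU := hF.isOpen
  have hΓ : ∀ m i j, DifferentiableAt ℝ (christoffel (firstForm F) m i j) y := fun m i j =>
    ((hF.contDiffOn_christoffel hG m i j).contDiffAt (hU.mem_nhds hy)).differentiableAt
      (by norm_num)
  have hGd : ∀ i j, DifferentiableAt ℝ (fun z => firstForm F z i j) y := fun i j =>
    ((hG i j).contDiffAt (hU.mem_nhds hy)).differentiableAt (by norm_num)
  have hB : ∀ k i j l, pd k (fun z => inner ℝ (pd i (pd j F) z) (pd l F z)) y =
      ∑ m, (pd k (christoffel (firstForm F) m i j) y * firstForm F y m l +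
        christoffel (firstForm F) m i j y * (inner ℝ (pd k (pd m F) y) (pd l F y) +
          inner ℝ (pd k (pd l F) y) (pd m F y))) := by
    intro k i j l
    have h1 : (fun z => inner ℝ (pd i (pd j F) z) (pd l F z)) =ᶠ[𝓝 y]
        fun z => ∑ m, christoffel (firstForm F) m i j z * firstForm F z m l := by
      filter_upwards [hU.mem_nhds hy] with z hz using (hF.sum_christoffel_mul hz i j l).symm
    have hm : ∀ m, DifferentiableAt ℝ
        (fun z => christoffel (firstForm F) m i j z * firstForm F z m l) y :=
      fun m => (hΓ m i j).mul (hGd m l)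
    rw [pd_congr h1, pd_sum fun m _ => hm m]
    refine Finset.sum_congr rfl fun m _ => ?_
    rw [pd_mul (hΓ m i j) (hGd m l), hF.pd_firstForm hy]
  have hFF : ∀ i j k l, inner ℝ (pd i (pd j F) y) (pd k (pd l F) y) =
      ∑ m, christoffel (firstForm F) m i j y * inner ℝ (pd k (pd l F) y) (pd m F y) +
        secondForm F y i j * secondForm F y k l := by
    intro i j k l
    conv_lhs => rw [hF.pd_pd_eq hy i j]
    rw [inner_add_left, inner_smul_left, sum_inner]
    simp only [inner_smul_left, RCLike.conj_to_real, secondForm, Matrix.of_apply]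
    congr 1
    · exact Finset.sum_congr rfl fun m _ => by rw [real_inner_comm (pd m F y)]
    · rw [real_inner_comm (pd k (pd l F) y)]
  have hS := hF.sum_christoffel_mul hy
  -- The uncontracted Gauss equation, with the upper index of the Riemann tensor lowered.
  have key : ∀ k l, ∑ m, (pd k (christoffel (firstForm F) m i j) y -
      pd j (christoffel (firstForm F) m i k) y +
      ∑ q, (christoffel (firstForm F) m k q y * christoffel (firstForm F) q i j y -
        christoffel (firstForm F) m j q y * christoffel (firstForm F) q i k y)) *
        firstForm F y m l =
      secondForm F y i j * secondForm F y k l - secondForm F y i k * secondForm F y j l := by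
    intro k l
    have h := hF.pd_inner_pd_pd_sub hG hy i j k l
    rw [hB, hB, hFF, hFF] at h
    simp only [← hS _ _ l] at h
    simp only [Fin.sum_univ_three] at h ⊢
    linear_combination h
  -- The index is raised again; setting `m = k` and summing then gives the Ricci tensor.
  have hinv : ∀ m k, pd k (christoffel (firstForm F) m i j) y -
      pd j (christoffel (firstForm F) m i k) y +
      ∑ q, (christoffel (firstForm F) m k q y * christoffel (firstForm F) q i j y -
        christoffel (firstForm F) m j q y * christoffel (firstForm F) q i k y) =
      ∑ l, (secondForm F y i j * secondForm F y k l - secondForm F y i k * secondForm F y j l) *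
        (firstForm F y)⁻¹ l m := by
    intro m k
    have hGG : ∀ i j, ∑ k, firstForm F y i k * (firstForm F y)⁻¹ k j = if i = j then 1 else 0 :=
      fun i j => by
        rw [← Matrix.mul_apply, Matrix.mul_nonsing_inv _ (Ne.isUnit (hF.det_ne_zero y hy)),
          Matrix.one_apply]
    simp only [← key, Finset.sum_mul (s := (Finset.univ : Finset (Fin 3))), mul_assoc]
    rw [Finset.sum_comm]
    simp only [← Finset.mul_sum, hGG]
    simp
  have hfin : ricciCoeff (firstForm F) i j y = ∑ k, ∑ l, (secondForm F y i j * secondForm F y k l -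
      secondForm F y i k * secondForm F y j l) * (firstForm F y)⁻¹ l k := by
    simp only [← hinv, ricciCoeff, ← Finset.sum_add_distrib]
  rw [hfin]
  have hs := hF.secondForm_symm hy
  simp only [gaussRicci, Matrix.sub_apply, Matrix.smul_apply, smul_eq_mul, Matrix.mul_apply,
    Matrix.trace_fin_three, Fin.sum_univ_three]
  rw [hs 1 0, hs 2 0, hs 2 1, hs j 0, hs j 1, hs j 2]
  have hI : ∀ a b, (firstForm F y)⁻¹ a b = (firstForm F y)⁻¹ b a := by
    have ht : (firstForm F y)ᵀ = firstForm F y := by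
      ext a b; simp only [firstForm, Matrix.transpose_apply, Matrix.of_apply]
      exact real_inner_comm _ _
    intro a b
    conv_lhs => rw [← ht, ← Matrix.transpose_nonsing_inv, Matrix.transpose_apply]
  rw [hI 1 0, hI 2 0, hI 2 1]
  ring

end IsLocalImmersion

/-! ### Behaviour under a change of parameters. -/

section Scaling

lemma pd_const_mul {i : Fin 3} {f : E3 → ℝ} {y : E3} (hf : DifferentiableAt ℝ f y) (c : ℝ) :
    pd i (fun z => c * f z) y = c * pd i f y := by
  rw [pd_mul (by fun_prop) hf, pd_const]; ring

/-- Used with powers of the sign `s = ±1` by which the unit normal changes under a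
reparametrization. -/
lemma formDensity_scale {f : E3 → ℝ} {X ν α β : E3 → E4} {y : E3} (hf : DifferentiableAt ℝ f y)
    (hX : DifferentiableAt ℝ X y) (hν : DifferentiableAt ℝ ν y) (hα : DifferentiableAt ℝ α y)
    (hβ : DifferentiableAt ℝ β y) (a b c d : ℝ) :
    formDensity (fun z => a * f z) X (fun z => b • ν z) (fun z => c • α z) (fun z => d • β z) y =
      a * b * c * d * formDensity f X ν α β y := by
  have h1 : ∀ {h : E3 → E4} (t : ℝ) (_ : DifferentiableAt ℝ h y) (i : Fin 3),
      pd i (fun z => t • h z) y = t • pd i h y := fun t hh i => by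
    rw [pd_smul (by fun_prop) hh, pd_const, zero_smul, zero_add]
  have h2 : ∀ (t : ℝ) (p q r s : E4), det4 p (t • q) r s = t * det4 p q r s := fun t p q r s => by
    simp [det4_eq]; ring
  have h3 : ∀ (t : ℝ) (p q r s : E4), det4 p q (t • r) s = t * det4 p q r s := fun t p q r s => by
    simp [det4_eq]; ring
  have h4 : ∀ (t : ℝ) (p q r s : E4), det4 p q r (t • s) = t * det4 p q r s := fun t p q r s => by
    simp [det4_eq]; ring
  have hν' : DifferentiableAt ℝ (fun z => b • ν z) y := hν.const_smul b
  have hα' : DifferentiableAt ℝ (fun z => c • α z) y := hα.const_smul c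
  have hβ' : DifferentiableAt ℝ (fun z => d • β z) y := hβ.const_smul d
  rw [formDensity_eq (hf.const_mul a) hX hν' hα' hβ' (fun _ _ _ => rfl), formDensity_eq hf hX hν hα hβ (fun _ _ _ => rfl)]
  simp only [h1 _ hν, h1 _ hα, h1 _ hβ, pd_const_mul hf, h2, h3, h4]
  ring

end Scaling

section Reparametrization

/-- The Jacobian matrix of `τ`, with the derivatives in the direction of the `i`-th coordinate in
the `i`-th row. -/
def jacMatrix (τ : E3 → E3) (y : E3) : Matrix (Fin 3) (Fin 3) ℝ :=
  Matrix.of fun i a => pd i τ y a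

variable {V : Type*} [NormedAddCommGroup V] [NormedSpace ℝ V]

lemma eq_sum_smul_stdVec (v : E3) : v = ∑ a, v a • stdVec a := by
  ext k
  simp [stdVec, Fin.sum_univ_three]
  fin_cases k <;> simp

lemma pd_comp {τ : E3 → E3} {f : E3 → V} {y : E3} (hτ : DifferentiableAt ℝ τ y)
    (hf : DifferentiableAt ℝ f (τ y)) (i : Fin 3) :
    pd i (fun z => f (τ z)) y = ∑ a, jacMatrix τ y i a • pd a f (τ y) := by
  have h1 : pd i (fun z => f (τ z)) y = fderiv ℝ f (τ y) (pd i τ y) := by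
    have := (hf.hasFDerivAt.comp y hτ.hasFDerivAt).fderiv
    unfold pd
    rw [show (fun z => f (τ z)) = f ∘ τ from rfl, this]; rfl
  rw [h1]
  conv_lhs => rw [eq_sum_smul_stdVec (pd i τ y)]
  simp [jacMatrix, pd]

lemma jac_comp {τ : E3 → E3} {u v w : E3 → ℝ} {y : E3} (hτ : DifferentiableAt ℝ τ y)
    (hu : DifferentiableAt ℝ u (τ y)) (hv : DifferentiableAt ℝ v (τ y))
    (hw : DifferentiableAt ℝ w (τ y)) :
    jac (fun z => u (τ z)) (fun z => v (τ z)) (fun z => w (τ z)) y =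
      (jacMatrix τ y).det * jac u v w (τ y) := by
  simp only [jac_eq, pd_comp hτ hu, pd_comp hτ hv, pd_comp hτ hw, Matrix.det_fin_three,
    Fin.sum_univ_three, smul_eq_mul]
  ring

lemma formDensity_comp {τ : E3 → E3} {f : E3 → ℝ} {X ν α β : E3 → E4} {y : E3}
    (hτ : DifferentiableAt ℝ τ y) (hf : DifferentiableAt ℝ f (τ y))
    (hX : DifferentiableAt ℝ X (τ y)) (hν : DifferentiableAt ℝ ν (τ y))
    (hα : DifferentiableAt ℝ α (τ y)) (hβ : DifferentiableAt ℝ β (τ y)) :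
    formDensity (fun z => f (τ z)) (fun z => X (τ z)) (fun z => ν (τ z)) (fun z => α (τ z))
      (fun z => β (τ z)) y = (jacMatrix τ y).det * formDensity f X ν α β (τ y) := by
  simp only [formDensity, Finset.mul_sum]
  refine Finset.sum_congr rfl fun a _ => Finset.sum_congr rfl fun b _ => ?_
  exact jac_comp (u := fun z => f z * det4 (X z) (ν z) (EuclideanSpace.single a 1)
    (EuclideanSpace.single b 1)) (v := fun z => α z a) (w := fun z => β z b) hτ
    (hf.mul (differentiableAt_det4 hX hν _ _)) ((differentiableAt_piLp 2).1 hα a)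
    ((differentiableAt_piLp 2).1 hβ b)

lemma gaussKroneckerCoord_eq (F : E3 → E4) (y : E3) :
    gaussKroneckerCoord F y = (secondForm F y).det / (firstForm F y).det := by
  rw [gaussKroneckerCoord, Matrix.det_mul, Matrix.det_nonsing_inv, Ring.inverse_eq_inv',
    inv_mul_eq_div]

lemma unitNormal_eventuallyEq {F F' : E3 → E4} {y : E3} (h : F =ᶠ[𝓝 y] F') :
    unitNormal F =ᶠ[𝓝 y] unitNormal F' := by
  filter_upwards [h.eventuallyEq_nhds] with z hz
  simp only [unitNormal, pd_congr hz]

lemma density_congr {η η' : E3 → ℝ} {F F' : E3 → E4} {y : E3} (hη : η =ᶠ[𝓝 y] η')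
    (h : F =ᶠ[𝓝 y] F') : density η F y = density η' F' y := by
  have hν := unitNormal_eventuallyEq h
  have hs : support F =ᶠ[𝓝 y] support F' := by
    filter_upwards [h, hν] with z h1 h2; simp only [support, h1, h2]
  unfold density
  congr 1
  · congr 1
    · exact formDensity_congr hη h hν h h
    · refine formDensity_congr ?_ h hν h hν
      filter_upwards [hη, hs] with z h1 h2; rw [h1, h2]
  · refine formDensity_congr ?_ h hν hν hν
    filter_upwards [hη, hs] with z h1 h2; rw [h1, h2]

/-- `F'` is obtained from `F` by the change of parameters `τ`. -/
structure IsReparametrization (F : E3 → E4) (U : Set E3) (F' : E3 → E4) (V : Set E3)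
    (τ : E3 → E3) : Prop where
  left : IsLocalImmersion F U
  right : IsLocalImmersion F' V
  contDiffOn : ContDiffOn ℝ 1 τ V
  mapsTo : MapsTo τ V U
  eqOn : EqOn F' (F ∘ τ) V

namespace IsReparametrization

variable {F F' : E3 → E4} {U V : Set E3} {τ : E3 → E3} {y : E3}
  (h : IsReparametrization F U F' V τ)
include h

lemma differentiableAt (hy : y ∈ V) : DifferentiableAt ℝ τ y :=
  (h.contDiffOn.contDiffAt (h.right.isOpen.mem_nhds hy)).differentiableAt (by norm_num)

lemma eventuallyEq (hy : y ∈ V) : F' =ᶠ[𝓝 y] fun z => F (τ z) := by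
  filter_upwards [h.right.isOpen.mem_nhds hy] with z hz using h.eqOn hz

lemma pd_eq (hy : y ∈ V) (i : Fin 3) :
    pd i F' y = ∑ a, jacMatrix τ y i a • pd a F (τ y) := by
  rw [pd_congr (h.eventuallyEq hy), pd_comp (h.differentiableAt hy)
    (h.left.differentiableAt (h.mapsTo hy))]

lemma firstForm_eq (hy : y ∈ V) :
    firstForm F' y = jacMatrix τ y * firstForm F (τ y) * (jacMatrix τ y)ᵀ := by
  ext i j
  simp only [firstForm, Matrix.of_apply, h.pd_eq hy, Matrix.mul_apply, Matrix.transpose_apply,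
    Fin.sum_univ_three, inner_add_left, inner_add_right, inner_smul_left, inner_smul_right,
    RCLike.conj_to_real]
  ring

lemma det_firstForm_eq (hy : y ∈ V) :
    (firstForm F' y).det = (jacMatrix τ y).det ^ 2 * (firstForm F (τ y)).det := by
  rw [h.firstForm_eq hy, Matrix.det_mul, Matrix.det_mul, Matrix.det_transpose]; ring

lemma det_jacMatrix_ne_zero (hy : y ∈ V) : (jacMatrix τ y).det ≠ 0 := fun h0 =>
  h.right.det_ne_zero y hy (by rw [h.det_firstForm_eq hy, h0]; ring)

lemma sqrt_det_firstForm_eq (hy : y ∈ V) :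
    √(firstForm F' y).det = |(jacMatrix τ y).det| * √(firstForm F (τ y)).det := by
  rw [h.det_firstForm_eq hy, Real.sqrt_mul (sq_nonneg _), Real.sqrt_sq_eq_abs]

lemma unitNormal_eq (hy : y ∈ V) :
    unitNormal F' y = (SignType.sign (jacMatrix τ y).det : ℝ) • unitNormal F (τ y) := by
  have hc : cross (pd 0 F' y) (pd 1 F' y) (pd 2 F' y) =
      (jacMatrix τ y).det • cross (pd 0 F (τ y)) (pd 1 F (τ y)) (pd 2 F (τ y)) := by
    ext k
    simp only [h.pd_eq hy, PiLp.smul_apply, cross_apply, det4_eq, Fin.sum_univ_three,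
      Matrix.det_fin_three, PiLp.add_apply, smul_eq_mul]
    ring
  have h0 := h.det_jacMatrix_ne_zero hy
  rw [unitNormal, hc, norm_smul, unitNormal, smul_smul, smul_smul, mul_inv, Real.norm_eq_abs]
  congr 1
  rcases lt_or_gt_of_ne h0 with hlt | hgt
  · rw [sign_neg hlt, abs_of_neg hlt]
    simp only [SignType.coe_neg, SignType.coe_one]
    field_simp
  · rw [sign_pos hgt, abs_of_pos hgt]
    simp only [SignType.coe_one]
    field_simp

/-- The Jacobian is continuous and nonzero, so its sign is locally constant. As the normals are
related by a constant near `y`, the relation may be differentiated. -/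
lemma exists_sign (hy : y ∈ V) : ∃ s : ℝ, s ^ 2 = 1 ∧ s * (jacMatrix τ y).det =
    |(jacMatrix τ y).det| ∧ unitNormal F' =ᶠ[𝓝 y] fun z => s • unitNormal F (τ z) := by
  have hV := h.right.isOpen
  have hJ : ContinuousOn (fun z => (jacMatrix τ z).det) V := by
    have hc : ∀ i a, ContinuousOn (fun z => jacMatrix τ z i a) V := fun i a =>
      ((contDiffOn_piLp 2).1 (contDiffOn_pd (m := 0) hV h.contDiffOn (by norm_num) i)
        a).continuousOn
    simp only [Matrix.det_fin_three]
    fun_prop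
  have hJy := hJ.continuousAt (hV.mem_nhds hy)
  rcases lt_or_gt_of_ne (h.det_jacMatrix_ne_zero hy) with hlt | hgt
  · refine ⟨-1, by norm_num, by rw [abs_of_neg hlt]; ring, ?_⟩
    filter_upwards [hV.mem_nhds hy, hJy.eventually_lt continuousAt_const hlt] with z hz hz'
    rw [h.unitNormal_eq hz, sign_neg hz']
    simp
  · refine ⟨1, by norm_num, by rw [abs_of_pos hgt]; ring, ?_⟩
    filter_upwards [hV.mem_nhds hy, continuousAt_const.eventually_lt hJy hgt] with z hz hz'
    rw [h.unitNormal_eq hz, sign_pos hz']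
    simp

/-- Counting one factor `s` for each `ν` and each `p`, the three forms scale by `s`, `s³` and `s⁵`,
all equal to `s`. Together with the Jacobian this gives `s det J = |det J|`: the expression is a
density, insensitive to orientation. -/
lemma density_eq (hy : y ∈ V) {η : E3 → ℝ} (hη : DifferentiableAt ℝ η (τ y)) :
    density (fun z => η (τ z)) F' y = |(jacMatrix τ y).det| * density η F (τ y) := by
  obtain ⟨s, hs, hsJ, hν⟩ := h.exists_sign hy
  have hF := h.eventuallyEq hy
  have hyU := h.mapsTo hy
  have hτ := h.differentiableAt hy
  have hFd := h.left.differentiableAt hyU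
  have hνd := h.left.differentiableAt_unitNormal hyU
  have hpd : DifferentiableAt ℝ (support F) (τ y) :=
    (h.left.contDiffOn_support.contDiffAt (h.left.isOpen.mem_nhds hyU)).differentiableAt
      (by norm_num)
  have hFd' : DifferentiableAt ℝ (fun z => F (τ z)) y := hFd.comp y hτ
  have hνd' : DifferentiableAt ℝ (fun z => unitNormal F (τ z)) y := hνd.comp y hτ
  have hpd' : DifferentiableAt ℝ (fun z => support F (τ z)) y := hpd.comp y hτ
  have hηd' : DifferentiableAt ℝ (fun z => η (τ z)) y := hη.comp y hτ
  have hp : support F' =ᶠ[𝓝 y] fun z => s * support F (τ z) := by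
    filter_upwards [hF, hν] with z h1 h2
    simp only [support, h1, h2, inner_smul_right]
  have hF1 : F' =ᶠ[𝓝 y] fun z => (1 : ℝ) • F (τ z) := by simpa using hF
  have e1 : formDensity (fun z => η (τ z)) F' (unitNormal F') F' F' y =
      s * (jacMatrix τ y).det * formDensity η F (unitNormal F) F F (τ y) := by
    rw [formDensity_congr (f' := fun z => 1 * η (τ z)) (by simp) hF hν hF1 hF1,
      formDensity_scale hηd' hFd' hνd' hFd' hFd', formDensity_comp hτ hη hFd hνd hFd hFd]
    ring
  have e2 : formDensity (fun z => η (τ z) * support F' z) F' (unitNormal F') F' (unitNormal F') y =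
      s ^ 2 * s * (jacMatrix τ y).det * formDensity (fun z => η z * support F z) F (unitNormal F) F
        (unitNormal F) (τ y) := by
    have hf : (fun z => η (τ z) * support F' z) =ᶠ[𝓝 y]
        fun z => s * (η (τ z) * support F (τ z)) := by
      filter_upwards [hp] with z hz; rw [hz]; ring
    have hd1 : DifferentiableAt ℝ (fun z => η z * support F z) (τ y) := hη.mul hpd
    have hd2 : DifferentiableAt ℝ (fun z => η (τ z) * support F (τ z)) y := hηd'.mul hpd'
    rw [formDensity_congr hf hF hν hF1 hν, formDensity_scale hd2 hFd' hνd' hFd' hνd']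
    rw [formDensity_comp (f := fun z => η z * support F z) hτ hd1 hFd hνd hFd hνd]
    ring
  have e3 : formDensity (fun z => η (τ z) * support F' z ^ 2) F' (unitNormal F') (unitNormal F')
        (unitNormal F') y =
      (s ^ 2) ^ 2 * s * (jacMatrix τ y).det * formDensity (fun z => η z * support F z ^ 2) F
        (unitNormal F) (unitNormal F) (unitNormal F) (τ y) := by
    have hf : (fun z => η (τ z) * support F' z ^ 2) =ᶠ[𝓝 y]
        fun z => s ^ 2 * (η (τ z) * support F (τ z) ^ 2) := by
      filter_upwards [hp] with z hz; rw [hz]; ring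
    have hd1 : DifferentiableAt ℝ (fun z => η z * support F z ^ 2) (τ y) := hη.mul (hpd.pow 2)
    have hd2 : DifferentiableAt ℝ (fun z => η (τ z) * support F (τ z) ^ 2) y :=
      hηd'.mul (hpd'.pow 2)
    rw [formDensity_congr hf hF hν hν hν, formDensity_scale hd2 hFd' hνd' hνd' hνd']
    rw [formDensity_comp (f := fun z => η z * support F z ^ 2) hτ hd1 hFd hνd hνd hνd]
    ring
  rw [density, e1, e2, e3, hs, density, ← hsJ]
  ring

lemma support_sq_eq (hy : y ∈ V) : support F' y ^ 2 = support F (τ y) ^ 2 := by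
  obtain ⟨s, hs, -, hν⟩ := h.exists_sign hy
  rw [support, support, h.eqOn hy, hν.eq_of_nhds, inner_smul_right, mul_pow, hs, one_mul]
  rfl

lemma abs_gaussKroneckerCoord_eq (hy : y ∈ V) :
    |gaussKroneckerCoord F' y| = |gaussKroneckerCoord F (τ y)| := by
  obtain ⟨s, hs, -, hν⟩ := h.exists_sign hy
  have hyU := h.mapsTo hy
  have hτ := h.differentiableAt hy
  have hνd := h.left.differentiableAt_unitNormal hyU
  have hνd' : DifferentiableAt ℝ (fun z => unitNormal F (τ z)) y := hνd.comp y hτ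
  have hν' : ∀ i, pd i (unitNormal F') y =
      s • ∑ a, jacMatrix τ y i a • pd a (unitNormal F) (τ y) := fun i => by
    rw [pd_congr hν, pd_smul (by fun_prop) hνd', pd_const, zero_smul, zero_add, pd_comp hτ hνd]
  have hh : secondForm F' y =
      s • (jacMatrix τ y * secondForm F (τ y) * (jacMatrix τ y)ᵀ) := by
    ext i j
    -- Writing the second form as `-⟨∂F, ∂ν⟩` involves first derivatives only, so no second
    -- derivatives of `τ` appear.
    rw [← neg_neg (secondForm F' y i j), ← h.right.inner_pd_pd_unitNormal hy, hν', h.pd_eq hy]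
    simp only [inner_smul_right, inner_add_left, inner_add_right, inner_smul_left,
      h.left.inner_pd_pd_unitNormal hyU, Matrix.smul_apply, Matrix.mul_apply,
      Matrix.transpose_apply, Fin.sum_univ_three, RCLike.conj_to_real, smul_eq_mul]
    ring
  have h0 := h.det_jacMatrix_ne_zero hy
  have hG := h.left.det_ne_zero _ hyU
  have hsabs : |s| = 1 := by
    rw [← sq_eq_sq₀ (abs_nonneg _) zero_le_one, sq_abs, hs, one_pow]
  have e : gaussKroneckerCoord F' y = s ^ 3 * gaussKroneckerCoord F (τ y) := by
    rw [gaussKroneckerCoord_eq, gaussKroneckerCoord_eq, hh, h.det_firstForm_eq hy,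
      Matrix.det_smul, Matrix.det_mul, Matrix.det_mul, Matrix.det_transpose]
    simp only [Fintype.card_fin]
    field_simp
  rw [e, abs_mul, abs_pow, hsabs]
  simp

end IsReparametrization

end Reparametrization

/-! ### Charts of `M` as local immersions. -/

section Charts

variable {M : Type*} [TopologicalSpace M] [ChartedSpace E3 M]

/-- The local parametrization of the immersion `φ` given by the chart at `x`. -/
def chartMap (φ : M → E4) (x : M) (y : E3) : E4 := φ ((chartAt E3 x).symm y)

/-- The change of coordinates from the chart at `x'` to the chart at `x`. -/
def transition (x x' : M) (y : E3) : E3 := chartAt E3 x ((chartAt E3 x').symm y)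

/-- The domain of the change of coordinates from the chart at `x'` to the chart at `x`. -/
def transitionSource (x x' : M) : Set E3 :=
  (chartAt E3 x').target ∩ (chartAt E3 x').symm ⁻¹' (chartAt E3 x).source

lemma isOpen_transitionSource (x x' : M) : IsOpen (transitionSource x x') :=
  (chartAt E3 x').isOpen_inter_preimage_symm (chartAt E3 x).open_source

lemma chart_mem_transitionSource {x x' p : M} (hx : p ∈ (chartAt E3 x).source)
    (hx' : p ∈ (chartAt E3 x').source) : chartAt E3 x' p ∈ transitionSource x x' :=
  ⟨(chartAt E3 x').map_source hx', by simpa [(chartAt E3 x').left_inv hx'] using hx⟩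

lemma transition_chart {x x' p : M} (hx' : p ∈ (chartAt E3 x').source) :
    transition x x' (chartAt E3 x' p) = chartAt E3 x p := by
  rw [transition, (chartAt E3 x').left_inv hx']

variable [IsManifold (𝓡 3) ∞ M]

lemma contDiffOn_transition (x x' : M) :
    ContDiffOn ℝ ∞ (transition x x') (transitionSource x x') := by
  rw [← contMDiffOn_iff_contDiffOn]
  have h1 : ContMDiffOn (𝓡 3) (𝓡 3) ∞ (chartAt E3 x) (chartAt E3 x).source := contMDiffOn_chart
  have h2 : ContMDiffOn (𝓡 3) (𝓡 3) ∞ (chartAt E3 x').symm (chartAt E3 x').target :=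
    contMDiffOn_chart_symm
  exact h1.comp (h2.mono inter_subset_left) inter_subset_right

lemma mdifferentiableAt_chart_symm (x : M) {y : E3} (hy : y ∈ (chartAt E3 x).target) :
    MDifferentiableAt (𝓡 3) (𝓡 3) (chartAt E3 x).symm y :=
  (((contMDiffOn_chart_symm (I := 𝓡 3) (n := ∞) (x := x)).contMDiffAt
    ((chartAt E3 x).open_target.mem_nhds hy))).mdifferentiableAt (by simp)

lemma mfderiv_chart_symm_injective (x : M) {y : E3} (hy : y ∈ (chartAt E3 x).target) :
    Function.Injective (mfderiv (𝓡 3) (𝓡 3) (chartAt E3 x).symm y) := by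
  have : IsManifold (𝓡 3) 1 M := IsManifold.of_le (n := ∞) (by simp)
  intro v w hvw
  have h := (mdifferentiable_chart (I := 𝓡 3) x).comp_symm_deriv hy
  have h1 : ∀ v, mfderiv (𝓡 3) (𝓡 3) (chartAt E3 x) ((chartAt E3 x).symm y)
      (mfderiv (𝓡 3) (𝓡 3) (chartAt E3 x).symm y v) = v := fun v => congrArg (fun L => L v) h
  rw [← h1 v, ← h1 w, hvw]

variable {g : SmoothMetric M} {φ : M → E4}

lemma contDiffOn_chartMap (hφ : ContMDiff (𝓡 3) (𝓡 4) 2 φ) (x : M) :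
    ContDiffOn ℝ 2 (chartMap φ x) (chartAt E3 x).target := by
  rw [← contMDiffOn_iff_contDiffOn]
  have : IsManifold (𝓡 3) 2 M := IsManifold.of_le (n := ∞) (by norm_cast)
  exact hφ.comp_contMDiffOn contMDiffOn_chart_symm

lemma fderiv_chartMap (hφ : ContMDiff (𝓡 3) (𝓡 4) 2 φ) (x : M) {y : E3}
    (hy : y ∈ (chartAt E3 x).target) (v : E3) : fderiv ℝ (chartMap φ x) y v =
      mfderiv (𝓡 3) (𝓡 4) φ ((chartAt E3 x).symm y)
        (mfderiv (𝓡 3) (𝓡 3) (chartAt E3 x).symm y v) := by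
  have h1 : MDifferentiableAt (𝓡 3) (𝓡 4) φ ((chartAt E3 x).symm y) :=
    hφ.contMDiffAt.mdifferentiableAt (by norm_num)
  have h2 := mfderiv_comp y h1 (mdifferentiableAt_chart_symm x hy)
  rw [mfderiv_eq_fderiv] at h2
  exact congrArg (fun L : E3 →L[ℝ] E4 => L v) h2

lemma inner_fderiv_chartMap (h : IsIsometricImmersion g φ) (x : M) {y : E3}
    (hy : y ∈ (chartAt E3 x).target) (v w : E3) :
    inner ℝ (fderiv ℝ (chartMap φ x) y v) (fderiv ℝ (chartMap φ x) y w) =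
      g.inner ((chartAt E3 x).symm y) (mfderiv (𝓡 3) (𝓡 3) (chartAt E3 x).symm y v)
        (mfderiv (𝓡 3) (𝓡 3) (chartAt E3 x).symm y w) := by
  rw [fderiv_chartMap h.contMDiff x hy, fderiv_chartMap h.contMDiff x hy]
  exact h.isometric _ _ _

lemma metricCoeff_eq_firstForm (h : IsIsometricImmersion g φ) (x : M) {y : E3}
    (hy : y ∈ (chartAt E3 x).target) : metricCoeff g x y = firstForm (chartMap φ x) y := by
  ext i j
  exact (inner_fderiv_chartMap h x hy (stdVec i) (stdVec j)).symm

lemma sum_smul_pd {V : Type*} [NormedAddCommGroup V] [NormedSpace ℝ V] (F : E3 → V) (y v : E3) :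
    ∑ i, v i • pd i F y = fderiv ℝ F y v := by
  conv_rhs => rw [eq_sum_smul_stdVec v]
  simp [pd]

lemma dotProduct_firstForm_mulVec (F : E3 → E4) (y v : E3) :
    v.ofLp ⬝ᵥ (firstForm F y *ᵥ v.ofLp) = inner ℝ (fderiv ℝ F y v) (fderiv ℝ F y v) := by
  rw [← sum_smul_pd]
  simp only [dotProduct, Matrix.mulVec, firstForm, Matrix.of_apply, Fin.sum_univ_three,
    inner_add_left, inner_add_right, inner_smul_left, inner_smul_right, RCLike.conj_to_real]
  ring

lemma isLocalImmersion_chartMap (h : IsIsometricImmersion g φ) (x : M) :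
    IsLocalImmersion (chartMap φ x) (chartAt E3 x).target where
  isOpen := (chartAt E3 x).open_target
  contDiffOn := contDiffOn_chartMap h.contMDiff x
  det_ne_zero y hy hdet := by
    obtain ⟨v, hv0, hv⟩ := Matrix.exists_mulVec_eq_zero_iff.2 hdet
    have h1 := dotProduct_firstForm_mulVec (chartMap φ x) y (WithLp.toLp 2 v)
    rw [inner_fderiv_chartMap h x hy] at h1
    simp only [hv, dotProduct_zero] at h1
    by_contra
    have h2 : mfderiv (𝓡 3) (𝓡 3) (chartAt E3 x).symm y (WithLp.toLp 2 v : E3) ≠ 0 := fun h0 => by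
      refine hv0 ?_
      have := mfderiv_chart_symm_injective x hy (h0.trans (map_zero _).symm)
      exact congrArg WithLp.ofLp this
    exact (g.pos _ _ h2).ne h1

/-- Read from the `C²` immersion, the coefficients would only be `C¹`. The `C²` regularity required
by the Gauss equation comes from the smoothness of `g`, with the coordinate fields viewed as smooth
sections of the tangent bundle along the inverse chart. -/
lemma contDiffOn_metricCoeff (g : SmoothMetric M) (x : M) (i j : Fin 3) :
    ContDiffOn ℝ 2 (fun y => metricCoeff g x y i j) (chartAt E3 x).target := by
  rw [← contMDiffOn_iff_contDiffOn]
  intro y hy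
  have hmem := (chartAt E3 x).open_target.mem_nhds hy
  have hsymm : ContMDiffAt (𝓡 3) (𝓡 3) ∞ (chartAt E3 x).symm y :=
    contMDiffOn_chart_symm.contMDiffAt hmem
  have hc : ∀ i, ContMDiffAt (𝓡 3) ((𝓡 3).prod 𝓘(ℝ, E3)) 2 (fun y => Bundle.TotalSpace.mk' E3
      (E := fun p : M => TangentSpace (𝓡 3) p) ((chartAt E3 x).symm y) (coordVec x i y)) y := by
    intro i
    have : IsManifold (𝓡 3) 1 M := IsManifold.of_le (n := ∞) (by simp)
    rw [Bundle.contMDiffAt_totalSpace]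
    refine ⟨hsymm.of_le (by norm_cast), ?_⟩
    have h1 := (hsymm.mfderiv_const (m := 2) (by norm_cast)).clm_apply
      (contMDiffAt_const (c := (stdVec i : E3)) (I := 𝓡 3) (x := y) (n := 2))
    refine h1.congr_of_eventuallyEq ?_
    have hs : ∀ᶠ z in 𝓝 y, (chartAt E3 x).symm z ∈
        (chartAt E3 ((chartAt E3 x).symm y)).source :=
      hsymm.continuousAt.eventually_mem ((chartAt E3 _).open_source.mem_nhds
        (mem_chart_source _ _))
    filter_upwards [hs] with z hz
    have e := inTangentCoordinates_eq (I := 𝓡 3) (I' := 𝓡 3) (M := E3) (M' := M) id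
      (chartAt E3 x).symm (fun z => (mfderiv (𝓡 3) (𝓡 3) (chartAt E3 x).symm z : E3 →L[ℝ] E3))
      (x₀ := y) (x := z) (mem_univ z) hz
    rw [tangentBundleCore_coordChange_model_space] at e
    exact (congrArg (fun L : E3 →L[ℝ] E3 => L (stdVec i)) e).symm
  have hg : ContMDiffAt (𝓡 3) ((𝓡 3).prod 𝓘(ℝ, E3 →L[ℝ] E3 →L[ℝ] ℝ)) 2
      (fun y => Bundle.TotalSpace.mk' (E3 →L[ℝ] E3 →L[ℝ] ℝ)
        (E := fun p : M => TangentSpace (𝓡 3) p →L[ℝ] TangentSpace (𝓡 3) p →L[ℝ] ℝ)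
        ((chartAt E3 x).symm y) (g.inner ((chartAt E3 x).symm y))) y :=
    (g.contMDiff.of_le (by norm_cast)).contMDiffAt.comp y (hsymm.of_le (by norm_cast))
  have := ContMDiffAt.clm_bundle_apply₂ (F₃ := ℝ) (E₃ := Bundle.Trivial M ℝ) hg (hc i) (hc j)
  rw [Bundle.contMDiffAt_totalSpace] at this
  exact this.2.contMDiffWithinAt

end Charts

/-! ### The Riemannian volume measure. -/

/-- The least upper bound of a family of measures which agree where they overlap. -/
lemma iSup_measure_apply_of_subset {X ι : Type*} [MeasurableSpace X] {m : ι → Measure X}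
    {s : ι → Set X} (hs : ∀ i, MeasurableSet (s i)) (hm : ∀ i, m i (s i)ᶜ = 0)
    (h : ∀ i j E, MeasurableSet E → E ⊆ s i ∩ s j → m i E = m j E) (i : ι) {E : Set X}
    (hEs : E ⊆ s i) : (⨆ j, m j) E = m i E := by
  refine le_antisymm ?_ (le_iSup m i E)
  -- A single measure dominating all `m j` which coincides with `m i` on subsets of `s i`. This
  -- bounds the supremum there, even on sets that are not measurable.
  have hle : (⨆ j, m j) ≤ m i + (⊤ : Measure X).restrict (s i)ᶜ := by
    refine iSup_le fun j => Measure.le_iff.2 fun A hA => ?_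
    rw [Measure.add_apply, Measure.restrict_apply hA, ← measure_inter_add_sdiff A (hs i)]
    refine add_le_add ?_ ?_
    · rw [← measure_inter_add_sdiff (A ∩ s i) (hs j)]
      have h0 : m j ((A ∩ s i) \ s j) = 0 := measure_mono_null (fun _ hx => hx.2) (hm j)
      rw [h0, add_zero, h j i _ ((hA.inter (hs i)).inter (hs j)) fun x hx => ⟨hx.2, hx.1.2⟩]
      exact measure_mono fun x hx => hx.1.1
    · exact (show m j ≤ ⊤ from le_top) _
  refine (hle E).trans ?_
  have h0 : (⊤ : Measure X).restrict (s i)ᶜ E = 0 := by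
    rw [Measure.restrict_apply' (hs i).compl]
    have : E ∩ (s i)ᶜ = ∅ := by
      rw [← disjoint_iff_inter_eq_empty]; exact disjoint_compl_right_iff_subset.2 hEs
    rw [this, measure_empty]
  rw [Measure.add_apply, h0, add_zero]

lemma det_fderiv_eq (τ : E3 → E3) (y : E3) : (fderiv ℝ τ y).det = (jacMatrix τ y).det := by
  let b := (EuclideanSpace.basisFun (Fin 3) ℝ).toBasis
  rw [ContinuousLinearMap.det, ← LinearMap.det_toMatrix b, ← Matrix.det_transpose]
  congr 1

section Volume

variable {M : Type*} [TopologicalSpace M] [ChartedSpace E3 M] [IsManifold (𝓡 3) ∞ M]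
  {g : SmoothMetric M} {φ : M → E4}

lemma IsLocalImmersion.mono {F : E3 → E4} {U V : Set E3} (h : IsLocalImmersion F U)
    (hV : IsOpen V) (hVU : V ⊆ U) : IsLocalImmersion F V :=
  ⟨hV, h.contDiffOn.mono hVU, fun y hy => h.det_ne_zero y (hVU hy)⟩

lemma isReparametrization_transition (h : IsIsometricImmersion g φ) (x x' : M) :
    IsReparametrization (chartMap φ x) (chartAt E3 x).target (chartMap φ x')
      (transitionSource x x') (transition x x') where
  left := isLocalImmersion_chartMap h x
  right := (isLocalImmersion_chartMap h x').mono (isOpen_transitionSource x x') inter_subset_left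
  contDiffOn := (contDiffOn_transition x x').of_le (by simp)
  mapsTo := fun _ hy => (chartAt E3 x).map_source hy.2
  eqOn := fun y hy => by
    simp [chartMap, transition, (chartAt E3 x).left_inv hy.2]

/-- The coordinates, in the chart at `x`, of the points of a set. -/
def chartSet (x : M) (E : Set M) : Set E3 := (chartAt E3 x).target ∩ (chartAt E3 x).symm ⁻¹' E

lemma continuousOn_sqrt_det (g : SmoothMetric M) (x : M) :
    ContinuousOn (fun y => √(metricCoeff g x y).det) (chartAt E3 x).target := by
  have hc : ∀ i j, ContinuousOn (fun y => metricCoeff g x y i j) (chartAt E3 x).target :=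
    fun i j => (contDiffOn_metricCoeff g x i j).continuousOn
  simp only [Matrix.det_fin_three]
  refine ContinuousOn.sqrt ?_
  fun_prop

variable [MeasurableSpace M] [BorelSpace M]

omit [IsManifold (𝓡 3) ∞ M] in
lemma measurableSet_chartSet (x : M) {E : Set M} (hE : MeasurableSet E) :
    MeasurableSet (chartSet x E) := by
  have h1 : Continuous ((chartAt E3 x).target.domRestrict (chartAt E3 x).symm) :=
    (chartAt E3 x).continuousOn_symm.domRestrict
  have h2 : chartSet x E =
      Subtype.val '' ((chartAt E3 x).target.domRestrict (chartAt E3 x).symm ⁻¹' E) := by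
    ext y; simp [chartSet, and_comm]
  rw [h2]
  exact (chartAt E3 x).open_target.measurableSet.subtype_image (h1.measurable hE)

omit [IsManifold (𝓡 3) ∞ M] in
lemma aemeasurable_chart_symm (x : M) (f : E3 → ENNReal) : AEMeasurable (chartAt E3 x).symm
    ((volume.restrict (chartAt E3 x).target).withDensity f) :=
  ((chartAt E3 x).continuousOn_symm.aemeasurable
    (chartAt E3 x).open_target.measurableSet).mono_ac (withDensity_absolutelyContinuous _ _)

lemma chartVolume_apply (g : SmoothMetric M) (x : M) {E : Set M} (hE : MeasurableSet E) :
    chartVolume g x E = ∫⁻ y in chartSet x E, ENNReal.ofReal √(metricCoeff g x y).det := by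
  rw [chartVolume, Measure.map_apply_of_aemeasurable (aemeasurable_chart_symm x _) hE,
    withDensity_apply', Measure.restrict_restrict' (chartAt E3 x).open_target.measurableSet,
    inter_comm]
  rfl

lemma chartVolume_compl_source (g : SmoothMetric M) (x : M) :
    chartVolume g x (chartAt E3 x).sourceᶜ = 0 := by
  rw [chartVolume_apply g x (chartAt E3 x).open_source.measurableSet.compl]
  have : chartSet x (chartAt E3 x).sourceᶜ = ∅ := by
    ext y
    simp only [chartSet, mem_inter_iff, mem_preimage, mem_compl_iff, mem_empty_iff_false,
      iff_false, not_and, not_not]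
    exact fun hy => (chartAt E3 x).map_target hy
  simp [this]

/-- Change of variables along the transition map. The transformation law of `√det g` is taken from
that of the first fundamental forms, which is where the immersion enters. -/
lemma chartVolume_eq_of_subset (h : IsIsometricImmersion g φ) (x x' : M) {E : Set M}
    (hE : MeasurableSet E) (hEs : E ⊆ (chartAt E3 x).source ∩ (chartAt E3 x').source) :
    chartVolume g x E = chartVolume g x' E := by
  have hr := isReparametrization_transition h x x'
  have hsub : chartSet x' E ⊆ transitionSource x x' := fun y hy => ⟨hy.1, (hEs hy.2).1⟩
  have himg : chartSet x E = transition x x' '' chartSet x' E := by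
    ext z
    constructor
    · intro hz
      have hz' := (hEs hz.2).2
      refine ⟨chartAt E3 x' ((chartAt E3 x).symm z), ⟨(chartAt E3 x').map_source hz', ?_⟩, ?_⟩
      · rw [mem_preimage, (chartAt E3 x').left_inv hz']; exact hz.2
      · rw [transition_chart hz', (chartAt E3 x).right_inv hz.1]
    · rintro ⟨y, hy, rfl⟩
      have h1 := (hEs hy.2).1
      refine ⟨(chartAt E3 x).map_source h1, ?_⟩
      rw [mem_preimage, transition, (chartAt E3 x).left_inv h1]; exact hy.2
  have hinj : InjOn (transition x x') (chartSet x' E) := by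
    intro y hy z hz hyz
    have h1 := (chartAt E3 x).injOn (hEs hy.2).1 (hEs hz.2).1 hyz
    exact (chartAt E3 x').symm.injOn hy.1 hz.1 h1
  rw [chartVolume_apply g x hE, chartVolume_apply g x' hE, himg,
    lintegral_image_eq_lintegral_abs_det_fderiv_mul volume (measurableSet_chartSet x' hE)
      (fun y hy => (hr.differentiableAt (hsub hy)).hasFDerivAt.hasFDerivWithinAt) hinj]
  refine setLIntegral_congr_fun (measurableSet_chartSet x' hE) fun y hy => ?_
  rw [det_fderiv_eq, ← ENNReal.ofReal_mul (abs_nonneg _),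
    metricCoeff_eq_firstForm h x (hr.mapsTo (hsub hy)), metricCoeff_eq_firstForm h x' hy.1,
    hr.sqrt_det_firstForm_eq (hsub hy)]

lemma vol_apply_of_subset (h : IsIsometricImmersion g φ) (x : M) {E : Set M}
    (hE : E ⊆ (chartAt E3 x).source) : vol g E = chartVolume g x E :=
  iSup_measure_apply_of_subset (s := fun x => (chartAt E3 x).source)
    (fun x => (chartAt E3 x).open_source.measurableSet) (chartVolume_compl_source g)
    (fun x x' _ hE hEs => chartVolume_eq_of_subset h x x' hE hEs) x hE

lemma vol_restrict_source (h : IsIsometricImmersion g φ) (x : M) :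
    (vol g).restrict (chartAt E3 x).source = chartVolume g x := by
  ext E hE
  have hs := (chartAt E3 x).open_source.measurableSet
  rw [Measure.restrict_apply hE, vol_apply_of_subset h x inter_subset_right,
    ← measure_inter_add_sdiff E hs]
  have h0 : chartVolume g x (E \ (chartAt E3 x).source) = 0 :=
    measure_mono_null (fun _ hx => hx.2) (chartVolume_compl_source g x)
  rw [h0, add_zero]

/-- Needed for strictness in the main inequality: a nonnegative continuous function on `M` that is
nonzero somewhere must have positive integral. -/
lemma isOpenPosMeasure_vol (h : IsIsometricImmersion g φ) : (vol g).IsOpenPosMeasure where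
  open_pos U hU hne := by
    obtain ⟨p, hp⟩ := hne
    intro h0
    have h1 : vol g (U ∩ (chartAt E3 p).source) = 0 := measure_mono_null inter_subset_left h0
    have hUo := hU.inter (chartAt E3 p).open_source
    rw [vol_apply_of_subset h p inter_subset_right, chartVolume_apply g p hUo.measurableSet] at h1
    have hSo : IsOpen (chartSet p (U ∩ (chartAt E3 p).source)) :=
      (chartAt E3 p).isOpen_inter_preimage_symm hUo
    have hmem : chartAt E3 p p ∈ chartSet p (U ∩ (chartAt E3 p).source) :=
      ⟨mem_chart_target _ _, by
        simp [(chartAt E3 p).left_inv (mem_chart_source E3 p), hp, mem_chart_source]⟩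
    have hc : AEMeasurable (fun y => ENNReal.ofReal √(metricCoeff g p y).det)
        (volume.restrict (chartSet p (U ∩ (chartAt E3 p).source))) :=
      (((continuousOn_sqrt_det g p).mono inter_subset_left).aemeasurable
        hSo.measurableSet).ennreal_ofReal
    rw [lintegral_eq_zero_iff' hc, EventuallyEq, ae_restrict_iff' hSo.measurableSet] at h1
    have h2 : volume (chartSet p (U ∩ (chartAt E3 p).source)) = 0 := by
      refine measure_mono_null (fun y hy => ?_) h1
      have hpos := (isLocalImmersion_chartMap h p).sqrt_det_pos hy.1
      rw [← metricCoeff_eq_firstForm h p hy.1] at hpos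
      simp only [mem_compl_iff, mem_ofPred_eq, not_forall]
      exact ⟨hy, by simpa using hpos⟩
    exact hSo.measure_ne_zero volume ⟨_, hmem⟩ h2

lemma isFiniteMeasure_vol [CompactSpace M] (h : IsIsometricImmersion g φ) :
    IsFiniteMeasure (vol g) := by
  refine ⟨isCompact_univ.measure_lt_top_of_nhdsWithin fun p _ => ?_⟩
  rw [nhdsWithin_univ]
  obtain ⟨K, hK, hpK, hKt⟩ := exists_compact_subset (chartAt E3 p).open_target
    (mem_chart_target E3 p)
  have hO : IsOpen ((chartAt E3 p).source ∩ chartAt E3 p ⁻¹' interior K) :=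
    (chartAt E3 p).isOpen_inter_preimage isOpen_interior
  refine ⟨_, hO.mem_nhds ⟨mem_chart_source E3 p, hpK⟩, ?_⟩
  rw [vol_apply_of_subset h p inter_subset_left, chartVolume_apply g p hO.measurableSet]
  have hsub : chartSet p ((chartAt E3 p).source ∩ chartAt E3 p ⁻¹' interior K) ⊆ K := by
    rintro y ⟨hy, -, hy2⟩
    rw [mem_preimage, (chartAt E3 p).right_inv hy] at hy2
    exact interior_subset hy2
  refine (lintegral_mono_set hsub).trans_lt ?_
  have hi : IntegrableOn (fun y => √(metricCoeff g p y).det) K :=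
    ((continuousOn_sqrt_det g p).mono hKt).integrableOn_compact hK
  exact hi.lintegral_lt_top

/-- Integration in a chart of a function supported in the domain of the chart. -/
lemma integral_vol_eq (h : IsIsometricImmersion g φ) (x : M) {f : M → ℝ}
    (hf : Function.support f ⊆ (chartAt E3 x).source) (hfm : AEStronglyMeasurable f (vol g)) :
    ∫ p, f p ∂(vol g) = ∫ y in (chartAt E3 x).target,
      √(firstForm (chartMap φ x) y).det * f ((chartAt E3 x).symm y) := by
  have ht := (chartAt E3 x).open_target.measurableSet
  rw [← setIntegral_eq_integral_of_forall_compl_eq_zero (s := (chartAt E3 x).source)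
    fun p hp => by_contra fun h0 => hp (hf h0), vol_restrict_source h x]
  have hfm' : AEStronglyMeasurable f (chartVolume g x) := by
    rw [← vol_restrict_source h x]; exact hfm.restrict
  have hc : AEMeasurable (fun y => Real.toNNReal √(metricCoeff g x y).det)
      (volume.restrict (chartAt E3 x).target) :=
    ((continuousOn_sqrt_det g x).aemeasurable ht).real_toNNReal
  unfold chartVolume at hfm' ⊢
  rw [integral_map (aemeasurable_chart_symm x _) hfm']
  simp only [ENNReal.ofReal]
  rw [integral_withDensity_eq_integral_smul₀ hc]
  refine setIntegral_congr_fun ht fun y hy => ?_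
  rw [NNReal.smul_def, Real.coe_toNNReal _ (Real.sqrt_nonneg _), metricCoeff_eq_firstForm h x hy,
    smul_eq_mul]

end Volume

/-! ### Linearity, continuity and integral of the coordinate densities. -/

section Density

variable {U : Set E3} {f f' : E3 → ℝ} {X ν α β : E3 → E4} {y : E3}

lemma formDensity_add (hf : DifferentiableAt ℝ f y) (hf' : DifferentiableAt ℝ f' y)
    (hX : DifferentiableAt ℝ X y) (hν : DifferentiableAt ℝ ν y) (hα : DifferentiableAt ℝ α y)
    (hβ : DifferentiableAt ℝ β y) :
    formDensity (fun z => f z + f' z) X ν α β y =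
      formDensity f X ν α β y + formDensity f' X ν α β y := by
  have hff' : DifferentiableAt ℝ (fun z => f z + f' z) y := hf.add hf'
  rw [formDensity_eq hff' hX hν hα hβ (fun _ _ _ => rfl),
    formDensity_eq hf hX hν hα hβ (fun _ _ _ => rfl),
    formDensity_eq hf' hX hν hα hβ (fun _ _ _ => rfl)]
  simp only [pd_add hf hf']
  ring

lemma formDensity_eq_zero (hf : f =ᶠ[𝓝 y] fun _ => 0) : formDensity f X ν α β y = 0 := by
  refine Finset.sum_eq_zero fun a _ => Finset.sum_eq_zero fun b _ => ?_
  refine jac_eq_zero_of_notMem_tsupport (fun h => ?_) _ _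
  refine notMem_tsupport_iff_eventuallyEq.2 ?_ h
  filter_upwards [hf] with z hz
  simp [hz]

lemma density_eq_zero {F : E3 → E4} {η : E3 → ℝ} (hη : η =ᶠ[𝓝 y] fun _ => 0) :
    density η F y = 0 := by
  rw [density, formDensity_eq_zero hη, formDensity_eq_zero, formDensity_eq_zero]
  · simp
  · filter_upwards [hη] with z hz; simp [hz]
  · filter_upwards [hη] with z hz; simp [hz]

namespace IsLocalImmersion

variable {F : E3 → E4} {η η' : E3 → ℝ} (hF : IsLocalImmersion F U)
include hF

lemma differentiableAt_support (hy : y ∈ U) : DifferentiableAt ℝ (support F) y :=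
  (hF.contDiffOn_support.contDiffAt (hF.isOpen.mem_nhds hy)).differentiableAt (by norm_num)

lemma density_add (hy : y ∈ U) (hη : DifferentiableAt ℝ η y) (hη' : DifferentiableAt ℝ η' y) :
    density (fun z => η z + η' z) F y = density η F y + density η' F y := by
  have h1 := hF.differentiableAt hy
  have h2 := hF.differentiableAt_unitNormal hy
  have h3 := hF.differentiableAt_support hy
  simp only [density, add_mul]
  rw [formDensity_add hη hη' h1 h2 h1 h1, formDensity_add (by fun_prop) (by fun_prop) h1 h2 h1 h2,
    formDensity_add (by fun_prop) (by fun_prop) h1 h2 h2 h2]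
  ring

lemma continuousOn_density (hη : ContDiffOn ℝ 1 η U) : ContinuousOn (density η F) U := by
  have h1 : ContDiffOn ℝ 1 F U := hF.contDiffOn.of_le (by norm_num)
  have h2 := hF.contDiffOn_unitNormal
  have h3 := hF.contDiffOn_support
  exact ((continuousOn_formDensity hF.isOpen hη h1 h2 h1 h1).add
    (continuousOn_formDensity hF.isOpen (hη.mul h3) h1 h2 h1 h2)).add
    (continuousOn_formDensity hF.isOpen (hη.mul (h3.pow 2)) h1 h2 h2 h2)

lemma integral_density (hη : ContDiffOn ℝ 1 η U) (hc : HasCompactSupport η)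
    (hηU : tsupport η ⊆ U) : ∫ y, density η F y = 0 := by
  have h1 : ContDiffOn ℝ 1 F U := hF.contDiffOn.of_le (by norm_num)
  have h2 := hF.contDiffOn_unitNormal
  have h3 := hF.contDiffOn_support
  have i1 := integral_formDensity hF.isOpen hη hc hηU h1 h2 h1 h1
  have i2 := integral_formDensity hF.isOpen (hη.mul h3) hc.mul_right
    ((tsupport_mul_subset_left (f := η)).trans hηU) h1 h2 h1 h2
  have i3 := integral_formDensity hF.isOpen (hη.mul (h3.pow 2)) hc.mul_right
    ((tsupport_mul_subset_left (f := η)).trans hηU) h1 h2 h2 h2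
  have e1 := integral_add i1.1 i2.1
  have e2 := integral_add (i1.1.add i2.1) i3.1
  simp only [Pi.add_apply] at e1 e2
  unfold density
  refine e2.trans ?_
  rw [e1, i1.2, i2.2, i3.2]
  simp

lemma continuousOn_gaussKroneckerCoord : ContinuousOn (gaussKroneckerCoord F) U := by
  have h1 : ∀ i, ContinuousOn (pd i F) U := fun i => (hF.contDiffOn_pd i).continuousOn
  have h2 : ∀ i j, ContinuousOn (pd i (pd j F)) U := fun i j =>
    (Hypersurface.contDiffOn_pd (m := 0) hF.isOpen (hF.contDiffOn_pd j) (by norm_num)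
      i).continuousOn
  have hG : ∀ i j, ContinuousOn (fun y => firstForm F y i j) U := fun i j => (h1 i).inner (h1 j)
  have hh : ∀ i j, ContinuousOn (fun y => secondForm F y i j) U := fun i j =>
    (h2 i j).inner hF.contDiffOn_unitNormal.continuousOn
  rw [show gaussKroneckerCoord F = _ from funext (gaussKroneckerCoord_eq F)]
  refine ContinuousOn.div ?_ ?_ hF.det_ne_zero
  · simp only [Matrix.det_fin_three]; fun_prop
  · simp only [Matrix.det_fin_three]; fun_prop

lemma continuousOn_sqrt_det_firstForm : ContinuousOn (fun y => √(firstForm F y).det) U := by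
  have h1 : ∀ i, ContinuousOn (pd i F) U := fun i => (hF.contDiffOn_pd i).continuousOn
  have hG : ∀ i j, ContinuousOn (fun y => firstForm F y i j) U := fun i j => (h1 i).inner (h1 j)
  simp only [Matrix.det_fin_three]
  refine ContinuousOn.sqrt ?_
  fun_prop

lemma norm_sq_position (hy : y ∈ U) : ‖F y‖ ^ 2 =
    tangentialCoord F y ⬝ᵥ (firstForm F y *ᵥ tangentialCoord F y) + support F y ^ 2 := by
  have h1 := dotProduct_firstForm_mulVec F y (WithLp.toLp 2 (tangentialCoord F y))
  rw [← sum_smul_pd] at h1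
  simp only at h1
  have h2 : inner ℝ (∑ k, tangentialCoord F y k • pd k F y) (unitNormal F y) = (0 : ℝ) := by
    rw [sum_inner]; simp [inner_smul_left, inner_pd_unitNormal]
  rw [h1, ← real_inner_self_eq_norm_sq]
  conv_lhs => rw [hF.position_eq hy]
  rw [inner_add_left, inner_add_right, inner_add_right, inner_smul_right, h2, inner_smul_left,
    real_inner_comm _ (unitNormal F y), h2, inner_smul_left, inner_smul_right, hF.inner_unitNormal_self hy]
  simp; ring

end IsLocalImmersion

end Density

/-! ### The integral formula on `M`. -/

section Global

variable {M : Type*} [TopologicalSpace M] [ChartedSpace E3 M]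

/-- The support function of `φ` at `p`, up to sign. -/
def supportAt (φ : M → E4) (p : M) : ℝ := support (chartMap φ p) (chartAt E3 p p)

/-- The density, with respect to the Riemannian volume, of the exterior derivative of the 2-form
`χ (det (X, ν, dX, dX) + p det (X, ν, dX, dν) + p² det (X, ν, dν, dν))` on `M`. -/
def formDiv (φ : M → E4) (χ : M → ℝ) (p : M) : ℝ :=
  density (fun y => χ ((chartAt E3 p).symm y)) (chartMap φ p) (chartAt E3 p p) /
    √(firstForm (chartMap φ p) (chartAt E3 p p)).det

/-- The quantities at `p` are defined in the preferred chart at `p`, which varies with `p` without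
any continuity. A formula valid in each fixed chart repairs this. -/
lemma continuous_of_chart {u : M → ℝ} {v : M → E3 → ℝ}
    (h : ∀ x p, p ∈ (chartAt E3 x).source → u p = v x (chartAt E3 x p))
    (hv : ∀ x, ContinuousOn (v x) (chartAt E3 x).target) : Continuous u := by
  rw [continuous_iff_continuousAt]
  intro x
  have hx := (chartAt E3 x).open_source.mem_nhds (mem_chart_source E3 x)
  have h1 : ContinuousOn (fun p => v x (chartAt E3 x p)) (chartAt E3 x).source :=
    (hv x).comp (chartAt E3 x).continuousOn (chartAt E3 x).mapsTo
  refine (h1.continuousAt hx).congr ?_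
  filter_upwards [hx] with p hp using (h x p hp).symm

variable [IsManifold (𝓡 3) ∞ M] {g : SmoothMetric M} {φ : M → E4} {χ χ' : M → ℝ}

lemma contDiffOn_comp_chart_symm (hχ : ContMDiff (𝓡 3) 𝓘(ℝ, ℝ) 1 χ) (x : M) :
    ContDiffOn ℝ 1 (fun y => χ ((chartAt E3 x).symm y)) (chartAt E3 x).target := by
  rw [← contMDiffOn_iff_contDiffOn]
  have : IsManifold (𝓡 3) 1 M := IsManifold.of_le (n := ∞) (by simp)
  exact hχ.comp_contMDiffOn contMDiffOn_chart_symm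

lemma differentiableAt_comp_chart_symm (hχ : ContMDiff (𝓡 3) 𝓘(ℝ, ℝ) 1 χ) (x : M) {y : E3}
    (hy : y ∈ (chartAt E3 x).target) :
    DifferentiableAt ℝ (fun y => χ ((chartAt E3 x).symm y)) y :=
  ((contDiffOn_comp_chart_symm hχ x).contDiffAt
    ((chartAt E3 x).open_target.mem_nhds hy)).differentiableAt (by norm_num)

/-- Independence of the chart: the density and the volume factor are both multiplied by `|det J|`,
which cancels in the quotient. -/
lemma formDiv_eq (h : IsIsometricImmersion g φ) (hχ : ContMDiff (𝓡 3) 𝓘(ℝ, ℝ) 1 χ) (x p : M)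
    (hp : p ∈ (chartAt E3 x).source) : formDiv φ χ p =
      density (fun y => χ ((chartAt E3 x).symm y)) (chartMap φ x) (chartAt E3 x p) /
        √(firstForm (chartMap φ x) (chartAt E3 x p)).det := by
  have hr := isReparametrization_transition h x p
  have hy := chart_mem_transitionSource hp (mem_chart_source E3 p)
  have hτ := transition_chart (x := x) (mem_chart_source E3 p)
  have hχd := differentiableAt_comp_chart_symm hχ x ((chartAt E3 x).map_source hp)
  rw [← hτ] at hχd
  have h1 := hr.density_eq hy hχd
  have h2 : (fun y => χ ((chartAt E3 p).symm y)) =ᶠ[𝓝 (chartAt E3 p p)]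
      fun y => χ ((chartAt E3 x).symm (transition x p y)) := by
    filter_upwards [(isOpen_transitionSource x p).mem_nhds hy] with y hy
    rw [transition, (chartAt E3 x).left_inv hy.2]
  rw [formDiv, density_congr h2 EventuallyEq.rfl, h1, hr.sqrt_det_firstForm_eq hy, hτ,
    mul_div_mul_left _ _ (abs_ne_zero.2 (hr.det_jacMatrix_ne_zero hy))]

lemma abs_gaussKronecker_eq (h : IsIsometricImmersion g φ) (x p : M)
    (hp : p ∈ (chartAt E3 x).source) :
    |gaussKronecker φ p| = |gaussKroneckerCoord (chartMap φ x) (chartAt E3 x p)| := by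
  have hr := isReparametrization_transition h x p
  have h1 := hr.abs_gaussKroneckerCoord_eq (chart_mem_transitionSource hp (mem_chart_source E3 p))
  rw [transition_chart (mem_chart_source E3 p)] at h1
  exact h1

lemma supportAt_sq_eq (h : IsIsometricImmersion g φ) (x p : M)
    (hp : p ∈ (chartAt E3 x).source) :
    supportAt φ p ^ 2 = support (chartMap φ x) (chartAt E3 x p) ^ 2 := by
  have hr := isReparametrization_transition h x p
  have h1 := hr.support_sq_eq (chart_mem_transitionSource hp (mem_chart_source E3 p))
  rw [transition_chart (mem_chart_source E3 p)] at h1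
  exact h1

lemma continuous_abs_gaussKronecker (h : IsIsometricImmersion g φ) :
    Continuous fun p => |gaussKronecker φ p| :=
  continuous_of_chart (v := fun x y => |gaussKroneckerCoord (chartMap φ x) y|)
    (abs_gaussKronecker_eq h)
    fun x => (isLocalImmersion_chartMap h x).continuousOn_gaussKroneckerCoord.abs

lemma continuous_supportAt_sq (h : IsIsometricImmersion g φ) :
    Continuous fun p => supportAt φ p ^ 2 :=
  continuous_of_chart (v := fun x y => support (chartMap φ x) y ^ 2) (supportAt_sq_eq h)
    fun x => (isLocalImmersion_chartMap h x).contDiffOn_support.continuousOn.pow 2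

lemma continuous_formDiv (h : IsIsometricImmersion g φ) (hχ : ContMDiff (𝓡 3) 𝓘(ℝ, ℝ) 1 χ) :
    Continuous (formDiv φ χ) := by
  refine continuous_of_chart (v := fun x y => density (fun y => χ ((chartAt E3 x).symm y))
    (chartMap φ x) y / √(firstForm (chartMap φ x) y).det) (formDiv_eq h hχ) fun x => ?_
  have hx := isLocalImmersion_chartMap h x
  exact (hx.continuousOn_density (contDiffOn_comp_chart_symm hχ x)).div
    hx.continuousOn_sqrt_det_firstForm fun y hy => (hx.sqrt_det_pos hy).ne'

lemma formDiv_add (h : IsIsometricImmersion g φ) (hχ : ContMDiff (𝓡 3) 𝓘(ℝ, ℝ) 1 χ)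
    (hχ' : ContMDiff (𝓡 3) 𝓘(ℝ, ℝ) 1 χ') (p : M) :
    formDiv φ (fun q => χ q + χ' q) p = formDiv φ χ p + formDiv φ χ' p := by
  have hy := mem_chart_target E3 p
  simp only [formDiv]
  rw [(isLocalImmersion_chartMap h p).density_add hy (differentiableAt_comp_chart_symm hχ p hy)
    (differentiableAt_comp_chart_symm hχ' p hy), add_div]

omit [IsManifold (𝓡 3) ∞ M] in
lemma formDiv_eq_zero_of_notMem_tsupport {p : M} (hp : p ∉ tsupport χ) : formDiv φ χ p = 0 := by
  have h1 := notMem_tsupport_iff_eventuallyEq.1 hp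
  rw [formDiv, density_eq_zero, zero_div]
  have hc : Tendsto (chartAt E3 p).symm (𝓝 (chartAt E3 p p)) (𝓝 p) :=
    (chartAt E3 p).tendsto_symm (mem_chart_source E3 p)
  exact hc.eventually h1

lemma formDiv_sum (h : IsIsometricImmersion g φ) {ι : Type*} (s : Finset ι) {χ : ι → M → ℝ}
    (hχ : ∀ i, ContMDiff (𝓡 3) 𝓘(ℝ, ℝ) 1 (χ i)) (p : M) :
    formDiv φ (fun q => ∑ i ∈ s, χ i q) p = ∑ i ∈ s, formDiv φ (χ i) p := by
  classical
  induction s using Finset.induction_on with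
  | empty =>
    simp only [Finset.sum_empty]
    exact formDiv_eq_zero_of_notMem_tsupport (by simp [tsupport])
  | insert a s ha ih =>
    simp only [Finset.sum_insert ha]
    rw [formDiv_add h (hχ a) (contMDiff_finsetSum fun i _ => hχ i), ih]

variable [MeasurableSpace M] [BorelSpace M]

lemma integral_formDiv_of_tsupport_subset [CompactSpace M] (h : IsIsometricImmersion g φ)
    (hχ : ContMDiff (𝓡 3) 𝓘(ℝ, ℝ) 1 χ) (x : M) (hx : tsupport χ ⊆ (chartAt E3 x).source) :
    ∫ p, formDiv φ χ p ∂(vol g) = 0 := by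
  classical
  have hF := isLocalImmersion_chartMap h x
  have ht := (chartAt E3 x).open_target
  have hsupp : Function.support (formDiv φ χ) ⊆ (chartAt E3 x).source := fun p hp =>
    hx (by_contra fun h0 => hp (formDiv_eq_zero_of_notMem_tsupport h0))
  -- The inverse chart has arbitrary values off its target, so the function is cut to zero there.
  let η : E3 → ℝ := (chartAt E3 x).target.indicator fun y => χ ((chartAt E3 x).symm y)
  have hη : EqOn η (fun y => χ ((chartAt E3 x).symm y)) (chartAt E3 x).target := fun y hy =>
    indicator_of_mem hy _
  have hK : IsCompact (chartAt E3 x '' tsupport χ) :=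
    (isClosed_tsupport χ).isCompact.image_of_continuousOn ((chartAt E3 x).continuousOn.mono hx)
  have hsub : tsupport η ⊆ chartAt E3 x '' tsupport χ := by
    refine closure_minimal (fun y hy => ?_) hK.isClosed
    have hyt : y ∈ (chartAt E3 x).target := by_contra fun h0 => hy (indicator_of_notMem h0 _)
    refine ⟨(chartAt E3 x).symm y, subset_tsupport χ ?_, (chartAt E3 x).right_inv hyt⟩
    exact fun h0 => hy ((hη hyt).trans h0)
  have hηU : tsupport η ⊆ (chartAt E3 x).target := by
    refine hsub.trans ?_
    rintro - ⟨p, hp, rfl⟩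
    exact (chartAt E3 x).map_source (hx hp)
  rw [integral_vol_eq h x hsupp (continuous_formDiv h hχ).aestronglyMeasurable,
    ← hF.integral_density ((contDiffOn_comp_chart_symm hχ x).congr hη)
      (hK.of_isClosed_subset (isClosed_tsupport η) hsub) hηU]
  rw [← setIntegral_eq_integral_of_forall_compl_eq_zero (s := (chartAt E3 x).target) fun y hy =>
    density_eq_zero (notMem_tsupport_iff_eventuallyEq.1 fun h0 => hy (hηU h0))]
  refine setIntegral_congr_fun ht.measurableSet fun y hy => ?_
  have he : η =ᶠ[𝓝 y] fun y => χ ((chartAt E3 x).symm y) := by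
    filter_upwards [ht.mem_nhds hy] with z hz using hη hz
  rw [density_congr he EventuallyEq.rfl, formDiv_eq h hχ x _ ((chartAt E3 x).map_target hy),
    (chartAt E3 x).right_inv hy, mul_div_cancel₀]
  exact (hF.sqrt_det_pos hy).ne'

/-- A partition of unity subordinate to the chart domains splits the constant 1; by compactness only
finitely many members are nonzero, and `formDiv` is additive. -/
lemma integral_formDiv_one [CompactSpace M] [T2Space M] (h : IsIsometricImmersion g φ) :
    ∫ p, formDiv φ (fun _ => 1) p ∂(vol g) = 0 := by
  have := isFiniteMeasure_vol h
  obtain ⟨f, hf⟩ := SmoothPartitionOfUnity.exists_isSubordinate_chartAt_source (𝓡 3) M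
  have hfin : {i | (Function.support (f i)).Nonempty}.Finite :=
    f.locallyFinite.finite_nonempty_of_compact
  have hf1 : ∀ i, ContMDiff (𝓡 3) 𝓘(ℝ, ℝ) 1 (f i) := fun i =>
    (f i).contMDiff.of_le (by simp)
  have hsum : (fun _ : M => (1 : ℝ)) = fun q => ∑ i ∈ hfin.toFinset, f i q := by
    ext q
    rw [← f.sum_eq_one (mem_univ q)]
    refine finsum_eq_sum_of_support_subset _ fun i hi => ?_
    simp only [Finite.coe_toFinset]
    exact ⟨q, hi⟩
  have hint : ∀ i, Integrable (formDiv φ (f i)) (vol g) := fun i =>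
    (continuous_formDiv h (hf1 i)).integrable_of_hasCompactSupport
      (HasCompactSupport.of_compactSpace _)
  rw [hsum]
  simp only [formDiv_sum h _ hf1]
  rw [integral_finsetSum _ fun i _ => hint i]
  exact Finset.sum_eq_zero fun i _ =>
    integral_formDiv_of_tsupport_subset h (hf1 i) i (hf i)

end Global

/-! ### The Ricci curvature, the pointwise estimate and the farthest point. -/

section Ricci

variable {M : Type*} [TopologicalSpace M] [ChartedSpace E3 M] [IsManifold (𝓡 3) ∞ M]
  {g : SmoothMetric M} {φ : M → E4}

/-- The Gauss equation on `M`. -/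
lemma exists_ricci_eq (h : IsIsometricImmersion g φ) (p : M) (n : E3) :
    ∃ v : TangentSpace (𝓡 3) p,
      ricci g p v v = n.ofLp ⬝ᵥ (gaussRicci (chartMap φ p) (chartAt E3 p p) *ᵥ n.ofLp) ∧
      g.inner p v v = n.ofLp ⬝ᵥ (firstForm (chartMap φ p) (chartAt E3 p p) *ᵥ n.ofLp) := by
  have hM : IsManifold (𝓡 3) 1 M := IsManifold.of_le (n := ∞) (by simp)
  have hp := mem_chart_source E3 p
  have hy := mem_chart_target E3 p
  have hF := isLocalImmersion_chartMap h p
  obtain ⟨v, hv⟩ := (mdifferentiable_chart (I := 𝓡 3) p).mfderiv_surjective hp n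
  refine ⟨v, ?_, ?_⟩
  · have hnear : metricCoeff g p =ᶠ[𝓝 (chartAt E3 p p)] firstForm (chartMap φ p) := by
      filter_upwards [(chartAt E3 p).open_target.mem_nhds hy] with y hy
        using metricCoeff_eq_firstForm h p hy
    have hG : ∀ i j, ContDiffOn ℝ 2 (fun z => firstForm (chartMap φ p) z i j)
        (chartAt E3 p).target := fun i j =>
      (contDiffOn_metricCoeff g p i j).congr fun z hz => by rw [metricCoeff_eq_firstForm h p hz]
    have h1 : ∀ i j, ricciCoeff (metricCoeff g p) i j (chartAt E3 p p) =
        gaussRicci (chartMap φ p) (chartAt E3 p p) i j := fun i j => by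
      rw [ricciCoeff_congr hnear, hF.ricciCoeff_firstForm hG hy]
    have h2 : ricci g p v v = ∑ i, ∑ j, ricciCoeff (metricCoeff g p) i j (chartAt E3 p p) *
        n i * n j := by
      rw [← hv]; rfl
    rw [h2]
    simp only [h1, dotProduct, Matrix.mulVec, Finset.mul_sum]
    exact Finset.sum_congr rfl fun i _ => Finset.sum_congr rfl fun j _ => by ring
  · rw [dotProduct_firstForm_mulVec, ← h.isometric]
    -- Factoring `φ` through the chart at `p` identifies `dφ(v)` with the coordinate derivative in
    -- the direction `n`.
    have h3 : φ =ᶠ[𝓝 p] chartMap φ p ∘ chartAt E3 p := by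
      filter_upwards [(chartAt E3 p).open_source.mem_nhds hp] with q hq
      simp [chartMap, (chartAt E3 p).left_inv hq]
    have h4 : MDifferentiableAt (𝓡 3) (𝓡 4) (chartMap φ p) (chartAt E3 p p) :=
      (hF.differentiableAt hy).mdifferentiableAt
    have h5 := mfderiv_comp p h4 ((mdifferentiable_chart (I := 𝓡 3) p).mdifferentiableAt hp)
    have h6 : (mfderiv (𝓡 3) (𝓡 4) φ p v : E4) =
        fderiv ℝ (chartMap φ p) (chartAt E3 p p) n := by
      rw [h3.mfderiv_eq, ← hv]
      rw [mfderiv_eq_fderiv] at h5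
      exact congrArg (fun L : E3 →L[ℝ] E4 => L v) h5
    exact congrArg (fun w : E4 => inner ℝ w w) h6

/-- The squared length of the tangential part of the position vector. -/
def tangentialSq (φ : M → E4) (p : M) : ℝ := ‖φ p‖ ^ 2 - supportAt φ p ^ 2

omit [IsManifold (𝓡 3) ∞ M] in
lemma chartMap_chart (φ : M → E4) (p : M) : chartMap φ p (chartAt E3 p p) = φ p := by
  rw [chartMap, (chartAt E3 p).left_inv (mem_chart_source E3 p)]

lemma tangentialSq_eq (h : IsIsometricImmersion g φ) (p : M) : tangentialSq φ p =
    tangentialCoord (chartMap φ p) (chartAt E3 p p) ⬝ᵥ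
      (firstForm (chartMap φ p) (chartAt E3 p p) *ᵥ
        tangentialCoord (chartMap φ p) (chartAt E3 p p)) := by
  have := (isLocalImmersion_chartMap h p).norm_sq_position (mem_chart_target E3 p)
  rw [chartMap_chart] at this
  rw [tangentialSq, this, supportAt]; ring

lemma tangentialSq_nonneg (h : IsIsometricImmersion g φ) (p : M) : 0 ≤ tangentialSq φ p := by
  have := dotProduct_firstForm_mulVec (chartMap φ p) (chartAt E3 p p)
    (WithLp.toLp 2 (tangentialCoord (chartMap φ p) (chartAt E3 p p)))
  rw [tangentialSq_eq h]
  exact this ▸ real_inner_self_nonneg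

lemma continuous_tangentialSq (h : IsIsometricImmersion g φ) : Continuous (tangentialSq φ) :=
  (h.contMDiff.continuous.norm.pow 2).sub (continuous_supportAt_sq h)

/-- The Ricci hypothesis is applied to the tangential part of the position vector, and the term in
`K` is bounded using `t + s² ≤ R²`, with `t` the squared tangential length and `s` the support
function. -/
lemma formDiv_one_ge (h : IsIsometricImmersion g φ) {R c : ℝ} (hR : 0 < R)
    (hball : range φ ⊆ Metric.closedBall 0 R)
    (hRic : ∀ (p : M) (v : TangentSpace (𝓡 3) p), -c * g.inner p v v ≤ ricci g p v v) (p : M) :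
    6 - c * tangentialSq φ p - 6 * R ^ 3 * |gaussKronecker φ p| ≤
      formDiv φ (fun _ => 1) p := by
  have hF := isLocalImmersion_chartMap h p
  have hy := mem_chart_target E3 p
  have hT := tangentialSq_eq h p
  have hT0 := tangentialSq_nonneg h p
  have hT1 : tangentialSq φ p + supportAt φ p ^ 2 ≤ R ^ 2 := by
    have h1 : ‖φ p‖ ≤ R := by simpa using hball (mem_range_self p)
    have h2 : ‖φ p‖ ^ 2 ≤ R ^ 2 := by gcongr
    rw [tangentialSq]; linarith
  obtain ⟨v, hv1, hv2⟩ := exists_ricci_eq h p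
    (WithLp.toLp 2 (tangentialCoord (chartMap φ p) (chartAt E3 p p)))
  have hQ := hRic p v
  rw [hv1, hv2] at hQ
  simp only [← hT] at hQ
  rw [formDiv, hF.density_one hy, mul_div_cancel_left₀ _ (hF.sqrt_det_pos hy).ne', ← hT]
  have hs : supportAt φ p = support (chartMap φ p) (chartAt E3 p p) := rfl
  have hK : gaussKronecker φ p = gaussKroneckerCoord (chartMap φ p) (chartAt E3 p p) := rfl
  rw [← hs, ← hK]
  generalize tangentialSq φ p = t at *
  generalize supportAt φ p = s at *
  generalize gaussKronecker φ p = K at *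
  have hs1 : |s| ≤ R := abs_le_of_sq_le_sq (by linarith) hR.le
  -- Since `0 ≤ t` and `t + s² ≤ R²`, the expression lies between `-2R²` and `3R²`; with `|s| ≤ R`
  -- this yields the constant `2 · R · 3R² = 6R³`.
  have hs2 : |3 * s ^ 2 - 2 * t| ≤ 3 * R ^ 2 := by
    rw [abs_le]; constructor <;> nlinarith [sq_nonneg s]
  have h3 : |2 * s * K * (3 * s ^ 2 - 2 * t)| ≤ 6 * R ^ 3 * |K| := by
    have : |2 * s * K * (3 * s ^ 2 - 2 * t)| = 2 * |K| * (|s| * |3 * s ^ 2 - 2 * t|) := by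
      rw [abs_mul, abs_mul, abs_mul, abs_two]; ring
    rw [this]
    have h4 : |s| * |3 * s ^ 2 - 2 * t| ≤ R * (3 * R ^ 2) := by gcongr
    calc 2 * |K| * (|s| * |3 * s ^ 2 - 2 * t|) ≤ 2 * |K| * (R * (3 * R ^ 2)) := by gcongr
      _ = 6 * R ^ 3 * |K| := by ring
  have h5 := (abs_le.1 h3).1
  linarith

/-- At a point farthest from the origin `|φ|²` is critical, so the position vector is orthogonal to
the hypersurface. -/
lemma exists_tangentialSq_eq_zero [CompactSpace M] [Nonempty M] (h : IsIsometricImmersion g φ) :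
    ∃ p, tangentialSq φ p = 0 := by
  obtain ⟨p, -, hp⟩ := isCompact_univ.exists_isMaxOn univ_nonempty
    (h.contMDiff.continuous.norm.pow 2).continuousOn
  have hF := isLocalImmersion_chartMap h p
  have hy := mem_chart_target E3 p
  have hmax : IsLocalMax (fun y => inner ℝ (chartMap φ p y) (chartMap φ p y))
      (chartAt E3 p p) := by
    refine Eventually.of_forall fun y => ?_
    simp only [real_inner_self_eq_norm_sq, chartMap_chart]
    exact hp (mem_univ _)
  have hd : ∀ j, inner ℝ (pd j (chartMap φ p) (chartAt E3 p p))
      (chartMap φ p (chartAt E3 p p)) = (0 : ℝ) := by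
    intro j
    have h1 : pd j (fun y => inner ℝ (chartMap φ p y) (chartMap φ p y)) (chartAt E3 p p) = 0 := by
      rw [pd, hmax.fderiv_eq_zero]; rfl
    rw [pd_inner (hF.differentiableAt hy) (hF.differentiableAt hy),
      real_inner_comm (pd j (chartMap φ p) (chartAt E3 p p))] at h1
    linarith
  refine ⟨p, ?_⟩
  have h0 : tangentialCoord (chartMap φ p) (chartAt E3 p p) = 0 := by
    ext k; simp [tangentialCoord, hd]
  rw [tangentialSq_eq h, h0, zero_dotProduct]

end Ricci

end Hypersurface

end

/-! ### Integration of the pointwise estimate. -/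

theorem mainTheorem2 {M : Type*} [TopologicalSpace M] [ChartedSpace Hypersurface.E3 M]
    [IsManifold (𝓡 3) ∞ M] [T2Space M] [CompactSpace M] [Nonempty M]
    [MeasurableSpace M] [BorelSpace M]
    (g : Hypersurface.SmoothMetric M) (φ : M → Hypersurface.E4)
    (hφ : Hypersurface.IsIsometricImmersion g φ)
    (R : ℝ) (hR : 0 < R) (hball : range φ ⊆ Metric.closedBall 0 R)
    (α : ℝ) (hα₀ : 0 < α) (hα₆ : α < 6)
    (hRic : ∀ (p : M) (v : TangentSpace (𝓡 3) p),
      -(α / R ^ 2) * g.inner p v v ≤ Hypersurface.ricci g p v v) :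
    Hypersurface.vol g univ < ⊤ ∧
    Integrable (fun p => |Hypersurface.gaussKronecker φ p|) (Hypersurface.vol g) ∧
    (Hypersurface.vol g).real univ <
      6 / (6 - α) * R ^ 3 * Hypersurface.totalCurvature g φ := by
  have := Hypersurface.isFiniteMeasure_vol hφ
  have := Hypersurface.isOpenPosMeasure_vol hφ
  have hint : ∀ {f : M → ℝ}, Continuous f → Integrable f (Hypersurface.vol g) := fun hf =>
    hf.integrable_of_hasCompactSupport (HasCompactSupport.of_compactSpace _)
  have hK := hint (Hypersurface.continuous_abs_gaussKronecker hφ)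
  refine ⟨measure_lt_top _ _, hK, ?_⟩
  have hTc := Hypersurface.continuous_tangentialSq hφ
  have hT := hint hTc
  have hc : Integrable (fun _ : M => (6 : ℝ)) (Hypersurface.vol g) := integrable_const _
  have hcT : Integrable (fun p => 6 - α / R ^ 2 * Hypersurface.tangentialSq φ p)
      (Hypersurface.vol g) := hc.sub (hT.const_mul _)
  have hle := integral_mono (hcT.sub (hK.const_mul (6 * R ^ 3)))
    (hint (Hypersurface.continuous_formDiv hφ contMDiff_const))
    (Hypersurface.formDiv_one_ge hφ hR hball hRic)
  rw [Hypersurface.integral_formDiv_one hφ] at hle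
  simp only [Pi.sub_apply] at hle
  rw [integral_sub hcT (hK.const_mul (6 * R ^ 3)), integral_sub hc (hT.const_mul (α / R ^ 2)),
    integral_const_mul, integral_const_mul, integral_const, smul_eq_mul] at hle
  -- Source of the strict inequality: the integrand is continuous and nonnegative, and equals `R²`
  -- where the tangential part vanishes.
  have hlt : 0 < ∫ p, (R ^ 2 - Hypersurface.tangentialSq φ p) ∂(Hypersurface.vol g) := by
    obtain ⟨p, hp⟩ := Hypersurface.exists_tangentialSq_eq_zero hφ
    refine (continuous_const.sub hTc).integral_pos_of_hasCompactSupport_nonneg_nonzero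
      (HasCompactSupport.of_compactSpace _) (fun q => ?_) (x := p) ?_
    · have h1 : ‖φ q‖ ≤ R := by simpa using hball (mem_range_self q)
      have h2 : ‖φ q‖ ^ 2 ≤ R ^ 2 := by gcongr
      simp only [Pi.zero_apply, Hypersurface.tangentialSq]
      nlinarith [sq_nonneg (Hypersurface.supportAt φ q)]
    · simp [hp, hR.ne']
  rw [integral_sub (integrable_const _) hT, integral_const, smul_eq_mul] at hlt
  have hdef : Hypersurface.totalCurvature g φ =
      ∫ p, |Hypersurface.gaussKronecker φ p| ∂(Hypersurface.vol g) := rfl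
  rw [hdef]
  -- Strictness survives the multiplication because `α > 0`.
  have hlt' : α / R ^ 2 * ∫ p, Hypersurface.tangentialSq φ p ∂(Hypersurface.vol g) <
      α * (Hypersurface.vol g).real univ := by
    have h1 : α * (Hypersurface.vol g).real univ =
        α / R ^ 2 * ((Hypersurface.vol g).real univ * R ^ 2) := by
      field_simp
    rw [h1]
    exact mul_lt_mul_of_pos_left (by linarith) (by positivity)
  have h6 : 0 < 6 - α := by linarith
  rw [div_mul_eq_mul_div, div_mul_eq_mul_div, lt_div_iff₀ h6]
  linarith
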